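/- Let $D=[0,1]\times[0,1]$ and let $W_2^{(3,2)}(D)$ be the set of real functions $y(\xi,\eta)$ on $D$ such that $\frac{\partial^3 y}{\partial\xi^2\partial\eta}=\partial_\xi^2(\partial_\eta y)$ exists on $D$ and is completely (that is, absolutely, in the sense of Carathéodory) continuous on $D$, $\frac{\partial^5 y}{\partial\xi^3\partial\eta^2}=\partial_\xi^3(\partial_\eta^2y)$, which exists almost everywhere (more precisely: for almost every $\eta$, $\partial_\eta^2y$, $\partial_\xi\partial_\eta^2y$, $\partial_\xi^2\partial_\eta^2y$ exist at $(\xi,\eta)$ for all $\xi$ and $\partial_\xi^3\partial_\eta^2y$ for almost all $\xi$), belongs to $L^2(D)$, and $y(\xi,0)=y(0,\eta)=y(1,\eta)=0$ for all $\xi,\eta\in[0,1]$. Derivatives at the boundary are one-sided, and a function $w$ on $D$ is absolutely continuous in the sense of Carathéodory if $w(\xi,\eta)=w(0,0)+\int_0^\xi a+\int_0^\eta b+\int_0^\xi\!\int_0^\eta c$ with $a,b\in L^1[0,1]$, $c\in L^1(D)$. Put $$\begin{aligned}\langle y,v\rangle_{W_2^{(3,2)}}={}&\sum_{i=0}^1\int_0^1\partial_\eta^2\partial_\xi^i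 y(0,\eta)\,\partial_\eta^2\partial_\xi^i v(0,\eta)\,d\eta+\int_0^1\partial_\eta^2y(1,\eta)\,\partial_\eta^2v(1,\eta)\,d\eta\\&+\sum_{j=0}^1\langle\partial_\eta^jy(\cdot,0),\partial_\eta^jv(\cdot,0)\rangle_{W_2^3}+\int_0^1\!\!\int_0^1\partial_\xi^3\partial_\eta^2y\;\partial_\xi^3\partial_\eta^2v\;d\xi\,d\eta,\end{aligned}$$ where $\langle g,f\rangle_{W_2^3}=g(0)f(0)+g'(0)f'(0)+g(1)f(1)+\int_0^1g'''f'''\,d\xi$. Let $K_{(x,t)}(\xi,\eta)=R_x^{\{3\}}(\xi)\,R_t^{\{2\}}(\eta)$, where $$R_t^{\{2\}}(\eta)=\begin{cases}\eta t+\frac12t\eta^2-\frac16\eta^3,&\eta\le t,\\-\frac16t^3+\frac12\eta t^2+t\eta,&\eta>t,\end{cases}$$ $$R_x^{\{3\}}(\xi)=\begin{cases}-\frac1{120}(x-1)\xi\,(\xi x^4-4\xi x^3+6\xi x^2+x\xi^4-5x\xi^3-120x\xi+120x+\xi^4),&\xi\le x,\\-\frac1{120}(\xi-1)x\,(x\xi^4-4x\xi^3+6x\xi^2+\xi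 x^4-5\xi x^3-120\xi x+120\xi+x^4),&\xi>x.\end{cases}$$ Let $0<\alpha\le1$, let $k_1,k_2,k_3$ be continuous on $D$, and let $$Ly=D_\eta^\alpha y+k_1\,y_{\xi\xi}+k_2\,y+k_3\,y_\xi ,$$ where $D_\eta^\alpha$ is the Caputo derivative $D_\eta^\alpha y(\xi,\eta)=\frac1{\Gamma(1-\alpha)}\int_0^\eta\frac{\partial_ry(\xi,r)}{(\eta-r)^\alpha}\,dr$ for $\alpha<1$ and $D_\eta^1y=\partial_\eta y$. Let $(\xi_i,\eta_i)_{i\ge1}$ be a sequence of points of $D$ (for instance one enumerating a countable dense subset), and put $$\psi_i(\xi,\eta)=L_{(x,t)}K_{(x,t)}(\xi,\eta)\big|_{(x,t)=(\xi_i,\eta_i)},$$ where $L_{(x,t)}$ acts on $K_{(x,t)}(\xi,\eta)$ as a function of $(x,t)$. **Theorem 3.1.** $K$ is the reproducing kernel of $W_2^{(3,2)}(D)$, that is, $K_{(x,t)}\in W_2^{(3,2)}(D)$ and $\langle y,K_{(x,t)}\rangle_{W_2^{(3,2)}}=y(x,t)$ for all $(x,t)\in D$ and all $y\in W_2^{(3,2)}(D)$;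 and $\psi_i\in W_2^{(3,2)}(D)$ for every $i=1,2,\dots$. (So $\partial^3\psi_i/\partial\xi^2\partial\eta$ is completely continuous on $D$, $\partial^5\psi_i/\partial\xi^3\partial\eta^2\in L^2(D)$, and $\psi_i(\xi,0)=\psi_i(0,\eta)=\psi_i(1,\eta)=0$.) -/

import Mathlib

open MeasureTheory Set

noncomputable section

/-- The closed unit interval `[0,1]`. -/
def unitI : Set ℝ := Icc 0 1

/-- The closed unit square `D = [0,1] × [0,1]`. -/
def unitD : Set (ℝ × ℝ) := unitI ×ˢ unitI

/-- Derivative of a function on `[0,1]` (one-sided at the two end points). -/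
def dI (f : ℝ → ℝ) : ℝ → ℝ := fun s => derivWithin f unitI s

/-- The partial derivative `∂y/∂ξ` of a function on `D` with respect to the first variable. -/
def dXi (y : ℝ → ℝ → ℝ) : ℝ → ℝ → ℝ := fun ξ η => dI (fun s => y s η) ξ

/-- The partial derivative `∂y/∂η` of a function on `D` with respect to the second variable. -/
def dEta (y : ℝ → ℝ → ℝ) : ℝ → ℝ → ℝ := fun ξ η => dI (fun s => y ξ s) η

/-- `f` has a partial derivative with respect to the first variable at `(ξ, η)`. -/
def HasDXi (f : ℝ → ℝ → ℝ) (ξ η : ℝ) : Prop :=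
  DifferentiableWithinAt ℝ (fun s => f s η) unitI ξ

/-- `f` has a partial derivative with respect to the second variable at `(ξ, η)`. -/
def HasDEta (f : ℝ → ℝ → ℝ) (ξ η : ℝ) : Prop :=
  DifferentiableWithinAt ℝ (fun s => f ξ s) unitI η

/-- Complete (= absolute) continuity of a function of two variables on `D`, in the sense of
Carathéodory: `f` is an indefinite integral
`f(ξ,η) = f(0,0) + ∫₀^ξ a + ∫₀^η b + ∬_{[0,ξ]×[0,η]} c` with Lebesgue integrable `a`, `b`, `c`. -/
def AbsContOnD (f : ℝ → ℝ → ℝ) : Prop :=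
  ∃ (a b : ℝ → ℝ) (c : ℝ × ℝ → ℝ),
    IntegrableOn a unitI ∧ IntegrableOn b unitI ∧ IntegrableOn c unitD ∧
    ∀ ξ ∈ unitI, ∀ η ∈ unitI,
      f ξ η = f 0 0 + (∫ s in (0 : ℝ)..ξ, a s) + (∫ s in (0 : ℝ)..η, b s)
        + ∫ p in Icc 0 ξ ×ˢ Icc 0 η, c p

/-- Membership in `W_2^{(3,2)}(D)`: `∂³y/∂ξ²∂η` exists on `D` and is completely continuous there,
`∂⁵y/∂ξ³∂η²` (which exists almost everywhere) is in `L²(D)`, and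
`y(ξ,0) = y(0,η) = y(1,η) = 0`. Only the values of `y` on `D` matter. -/
structure MemW32 (y : ℝ → ℝ → ℝ) : Prop where
  /-- `∂y/∂η`, `∂²y/∂ξ∂η` and `∂³y/∂ξ²∂η` exist at every point of `D` -/
  exists_third : ∀ ξ ∈ unitI, ∀ η ∈ unitI,
    HasDEta y ξ η ∧ HasDXi (dEta y) ξ η ∧ HasDXi (dXi (dEta y)) ξ η
  absCont : AbsContOnD (dXi (dXi (dEta y)))
  /-- for almost every `η`, the derivatives `∂²y/∂η²`, `∂³y/∂ξ∂η²`, `∂⁴y/∂ξ²∂η²` exist at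
  `(ξ, η)` for all `ξ`, and `∂⁵y/∂ξ³∂η²` exists for almost all `ξ` -/
  exists_fifth : ∀ᵐ η ∂(volume.restrict unitI),
    (∀ ξ ∈ unitI, HasDEta (dEta y) ξ η ∧ HasDXi (dEta (dEta y)) ξ η ∧
      HasDXi (dXi (dEta (dEta y))) ξ η) ∧
    ∀ᵐ ξ ∂(volume.restrict unitI), HasDXi (dXi (dXi (dEta (dEta y)))) ξ η
  memL2 : MemLp (fun p : ℝ × ℝ => dXi (dXi (dXi (dEta (dEta y)))) p.1 p.2) 2
    (volume.restrict unitD)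
  initial : ∀ ξ ∈ unitI, y ξ 0 = 0
  boundary_left : ∀ η ∈ unitI, y 0 η = 0
  boundary_right : ∀ η ∈ unitI, y 1 η = 0

/-- The inner product of `W_2^3[0,1]`. -/
def innerW3 (g f : ℝ → ℝ) : ℝ :=
  g 0 * f 0 + dI g 0 * dI f 0 + g 1 * f 1
    + ∫ ξ in (0 : ℝ)..1, dI (dI (dI g)) ξ * dI (dI (dI f)) ξ

/-- The inner product of `W_2^{(3,2)}(D)`. -/
def innerW32 (y v : ℝ → ℝ → ℝ) : ℝ :=
  (∫ η in (0 : ℝ)..1, dEta (dEta y) 0 η * dEta (dEta v) 0 η)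
  + (∫ η in (0 : ℝ)..1, dEta (dEta (dXi y)) 0 η * dEta (dEta (dXi v)) 0 η)
  + (∫ η in (0 : ℝ)..1, dEta (dEta y) 1 η * dEta (dEta v) 1 η)
  + innerW3 (fun ξ => y ξ 0) (fun ξ => v ξ 0)
  + innerW3 (fun ξ => dEta y ξ 0) (fun ξ => dEta v ξ 0)
  + ∫ η in (0 : ℝ)..1, ∫ ξ in (0 : ℝ)..1,
      dXi (dXi (dXi (dEta (dEta y)))) ξ η * dXi (dXi (dXi (dEta (dEta v)))) ξ η

/-- `K x t` is the function `K_{(x,t)}`; `K` is a reproducing kernel of `W_2^{(3,2)}(D)`. -/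
structure IsReproducingKernelW32 (K : ℝ → ℝ → ℝ → ℝ → ℝ) : Prop where
  mem : ∀ x ∈ unitI, ∀ t ∈ unitI, MemW32 (K x t)
  reproducing : ∀ y : ℝ → ℝ → ℝ, MemW32 y →
    ∀ x ∈ unitI, ∀ t ∈ unitI, innerW32 y (K x t) = y x t

/-- The kernel function `R_t^{2}(η)` of `W_2^2[0,1]`. -/
def R2 (t η : ℝ) : ℝ :=
  if η ≤ t then η * t + 1 / 2 * t * η ^ 2 - 1 / 6 * η ^ 3
  else -(1 / 6) * t ^ 3 + 1 / 2 * η * t ^ 2 + t * η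

/-- The kernel function `R_x^{3}(ξ)` of `W_2^3[0,1]`. -/
def R3 (x ξ : ℝ) : ℝ :=
  if ξ ≤ x then
    -(1 / 120) * (x - 1) * ξ * (ξ * x ^ 4 - 4 * ξ * x ^ 3 + 6 * ξ * x ^ 2 + x * ξ ^ 4
      - 5 * x * ξ ^ 3 - 120 * x * ξ + 120 * x + ξ ^ 4)
  else
    -(1 / 120) * (ξ - 1) * x * (x * ξ ^ 4 - 4 * x * ξ ^ 3 + 6 * x * ξ ^ 2 + ξ * x ^ 4
      - 5 * ξ * x ^ 3 - 120 * ξ * x + 120 * ξ + x ^ 4)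

/-- The kernel `K_{(x,t)}(ξ,η) = R_x^{3}(ξ) R_t^{2}(η)`. -/
def kernelK (x t ξ η : ℝ) : ℝ := R3 x ξ * R2 t η

/-- Caputo derivative of order `0 < α ≤ 1` of a function on `[0,1]`; for `α = 1` it is the
ordinary derivative. -/
def caputo (α : ℝ) (g : ℝ → ℝ) (t : ℝ) : ℝ :=
  if α = 1 then dI g t
  else 1 / Real.Gamma (1 - α) * ∫ r in (0 : ℝ)..t, dI g r / (t - r) ^ α

/-- The operator `Ly = D_η^α y + k₁ y_ξξ + k₂ y + k₃ y_ξ`. -/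
def opL (α : ℝ) (k₁ k₂ k₃ : ℝ → ℝ → ℝ) (y : ℝ → ℝ → ℝ) (ξ η : ℝ) : ℝ :=
  caputo α (fun s => y ξ s) η + k₁ ξ η * dXi (dXi y) ξ η + k₂ ξ η * y ξ η
    + k₃ ξ η * dXi y ξ η

/-- `ψ(ξ,η) = L_{(x,t)} K_{(x,t)}(ξ,η)` evaluated at `(x,t) = (x₀,t₀)`. -/
def psi (α : ℝ) (k₁ k₂ k₃ : ℝ → ℝ → ℝ) (K : ℝ → ℝ → ℝ → ℝ → ℝ) (x₀ t₀ : ℝ) :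
    ℝ → ℝ → ℝ :=
  fun ξ η => opL α k₁ k₂ k₃ (fun x t => K x t ξ η) x₀ t₀

end

/-! ### Calculus on the unit interval -/

/-! Membership. A product f(ξ)g(η) lies in the space as soon as f is of W_2^3 type and vanishes at 0
and 1, and g is of W_2^2 type and vanishes at 0. `kernelK` is one such product and each ψ is a sum
of two (`memW32_of_eq_mul_add_mul`). Applying L in the parameters lowers the order of the truncated
powers in R_x and R_t, but enough remains: the worst top derivatives are jumps, which are still in
L². The Caputo derivative averages such jumps against an integrable weight, so its second
η-derivative is bounded.

Reproducing property. Let a, b, c be the Carathéodory densities of ∂_ξ²∂_ηy. For fixed η, ∂_ηy(·,η)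
vanishes at 0 and 1 and has third derivative a + ∫₀^η c. Taylor's formula, with the second
derivative at 0 eliminated through the condition at 1, recovers it as ξ(1-ξ)p(η) plus the integral
of that density against G(ξ,s) = (ξ-s)₊²/2 - ξ²(1-s)²/2, where p(η) = ∂_ξ∂_ηy(0,η). Integrating from
η = 0 gives (`CaratheodoryRepr.eq_repr`) y(ξ,t) = ξ(1-ξ)∫₀^t p + t∫G a + ∫₀^t(t-σ)∫G c. Now G(x,·)
is exactly ∂_ξ³R_x, ∂_ξR_x(0) = x(1-x), ∂_η²R_t = (t-η)₊ and ∂_ηR_t(0) = t, so the terms of the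
inner product are the pieces of this formula.

The analytic work is to identify almost everywhere the derivatives of y that occur in the inner
product: ∂_ξ³∂_ηy(·,0) = a, ∂_ξ³∂_η²y = c, and ∂_η²∂_ξy(0,·) = p', where the order of
differentiation differs from that in the definition of the space. -/

theorem zero_mem_unitI : (0 : ℝ) ∈ unitI := ⟨le_rfl, zero_le_one⟩

theorem one_mem_unitI : (1 : ℝ) ∈ unitI := ⟨zero_le_one, le_rfl⟩

theorem uniqueDiffOn_unitI : UniqueDiffOn ℝ unitI := uniqueDiffOn_Icc zero_lt_one

theorem measurableSet_unitI : MeasurableSet unitI := measurableSet_Icc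

theorem HasDerivWithinAt.dI_eq {f : ℝ → ℝ} {f' s : ℝ} (h : HasDerivWithinAt f f' unitI s)
    (hs : s ∈ unitI) : dI f s = f' :=
  h.derivWithin (uniqueDiffOn_unitI s hs)

theorem dI_congr {f g : ℝ → ℝ} (h : EqOn f g unitI) : EqOn (dI f) (dI g) unitI :=
  fun _ hs => derivWithin_congr h (h hs)

theorem dI_zero_of_eqOn {f : ℝ → ℝ} (h : ∀ x ∈ unitI, f x = 0) : ∀ x ∈ unitI, dI f x = 0 :=
  fun x hx => (HasDerivWithinAt.congr (hasDerivWithinAt_const x unitI (0 : ℝ)) h (h x hx)).dI_eq hx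

theorem volume_restrict_unitD :
    (volume : Measure (ℝ × ℝ)).restrict unitD =
      (volume.restrict unitI).prod (volume.restrict unitI) := by
  rw [unitD, Measure.volume_eq_prod, Measure.prod_restrict]

theorem uIoc_subset_unitI {x y : ℝ} (hx : x ∈ unitI) (hy : y ∈ unitI) : uIoc x y ⊆ unitI :=
  uIoc_subset_uIcc.trans (ordConnected_Icc.uIcc_subset hx hy)

theorem intervalIntegrable_of_unitI {w : ℝ → ℝ} (hw : IntegrableOn w unitI) {x y : ℝ}
    (hx : x ∈ unitI) (hy : y ∈ unitI) : IntervalIntegrable w volume x y :=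
  intervalIntegrable_iff.2 (hw.mono_set (uIoc_subset_unitI hx hy))

theorem integral_unitI (w : ℝ → ℝ) : ∫ s in unitI, w s = ∫ s in (0 : ℝ)..1, w s := by
  rw [intervalIntegral.integral_of_le zero_le_one, unitI, integral_Icc_eq_integral_Ioc]

theorem continuousOn_primitive_unitI {w : ℝ → ℝ} (hw : IntegrableOn w unitI) :
    ContinuousOn (fun x => ∫ s in (0 : ℝ)..x, w s) unitI := by
  have h := intervalIntegral.continuousOn_primitive_interval (a := 0) (b := 1) (f := w)
    (μ := volume) (by rwa [uIcc_of_le zero_le_one])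
  rwa [uIcc_of_le zero_le_one] at h

theorem ContinuousOn.integrableOn_unitI {w : ℝ → ℝ} (hw : ContinuousOn w unitI) :
    IntegrableOn w unitI :=
  hw.integrableOn_Icc

theorem hasDerivWithinAt_primitive {w : ℝ → ℝ} (hw : ContinuousOn w unitI) {x : ℝ}
    (hx : x ∈ unitI) :
    HasDerivWithinAt (fun x => ∫ s in (0 : ℝ)..x, w s) (w x) unitI x := by
  have : Fact (x ∈ Icc (0 : ℝ) 1) := ⟨hx⟩
  exact intervalIntegral.integral_hasDerivWithinAt_right (s := Icc 0 1) (t := Icc 0 1)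
    (intervalIntegrable_of_unitI hw.integrableOn_unitI zero_mem_unitI hx)
    (hw.stronglyMeasurableAtFilter_nhdsWithin measurableSet_unitI x) (hw x hx)

theorem ae_hasDerivWithinAt_primitive {w : ℝ → ℝ} (hw : IntegrableOn w unitI) :
    ∀ᵐ x ∂(volume.restrict unitI),
      HasDerivWithinAt (fun x => ∫ s in (0 : ℝ)..x, w s) (w x) unitI x := by
  rw [ae_restrict_iff' measurableSet_unitI]
  filter_upwards [(intervalIntegrable_of_unitI hw zero_mem_unitI
    one_mem_unitI).ae_hasDerivAt_integral] with x hx hxI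
  rw [uIcc_of_le zero_le_one] at hx
  exact (hx hxI 0 zero_mem_unitI).hasDerivWithinAt

theorem eq_add_integral_of_hasDerivWithinAt {f f' : ℝ → ℝ}
    (h : ∀ x ∈ unitI, HasDerivWithinAt f (f' x) unitI x) (hf' : ContinuousOn f' unitI) {x : ℝ}
    (hx : x ∈ unitI) : f x = f 0 + ∫ s in (0 : ℝ)..x, f' s := by
  have hsub : Icc 0 x ⊆ unitI := Icc_subset_Icc le_rfl hx.2
  rw [intervalIntegral.integral_eq_sub_of_hasDerivAt_of_le (f := f) hx.1 (fun s hs =>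
    ((h s (hsub hs)).continuousWithinAt).mono hsub) (fun s hs => (h s
    (hsub (Ioo_subset_Icc_self hs))).hasDerivAt (Icc_mem_nhds hs.1 (hs.2.trans_le hx.2)))
    (intervalIntegrable_of_unitI hf'.integrableOn_unitI zero_mem_unitI hx)]
  ring

/-- Cauchy's formula for repeated integration, one step. -/
theorem integral_sub_pow_succ_mul {w : ℝ → ℝ} (hw : IntegrableOn w unitI) (n : ℕ) {x : ℝ}
    (hx : x ∈ unitI) :
    ∫ s in (0 : ℝ)..x, (x - s) ^ (n + 1) * w s =
      (n + 1) * ∫ s in (0 : ℝ)..x, (x - s) ^ n * ∫ r in (0 : ℝ)..s, w r := by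
  have hint : IntervalIntegrable w volume 0 x := intervalIntegrable_of_unitI hw zero_mem_unitI hx
  -- The density w is only integrable, so integration by parts is done for absolutely continuous
  -- functions. Both boundary terms vanish: the power at s = x, the primitive at s = 0.
  have hφ : AbsolutelyContinuousOnInterval (fun s => (x - s) ^ (n + 1)) 0 x :=
    ContDiffOn.absolutelyContinuousOnInterval (by fun_prop)
  have hW := hint.absolutelyContinuousOnInterval_intervalIntegral (c := 0) left_mem_uIcc
  have h := hφ.integral_mul_deriv_eq_deriv_mul hW
  have hd : ∀ s, deriv (fun s => (x - s) ^ (n + 1)) s = -((n + 1) * (x - s) ^ n) := by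
    intro s
    have := (((hasDerivAt_id s).const_sub x).pow (n + 1)).deriv
    simp only [id, Pi.pow_def] at this
    rw [this]
    push_cast
    simp
  have h1 : ∫ s in (0 : ℝ)..x, (x - s) ^ (n + 1) * w s =
      ∫ s in (0 : ℝ)..x, (x - s) ^ (n + 1) * deriv (fun x => ∫ r in (0 : ℝ)..x, w r) s := by
    refine intervalIntegral.integral_congr_ae ?_
    filter_upwards [hint.ae_hasDerivAt_integral] with s hs hsx
    rw [(hs (uIoc_subset_uIcc hsx) 0 left_mem_uIcc).deriv]
  rw [h1, h]
  simp only [hd, sub_self, intervalIntegral.integral_same, mul_zero, ne_eq, Nat.add_eq_zero_iff,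
    one_ne_zero, and_false, not_false_eq_true, zero_pow, zero_mul, zero_sub, neg_mul,
    intervalIntegral.integral_neg, neg_neg]
  rw [← intervalIntegral.integral_const_mul]
  simp only [mul_assoc]

theorem integral_sub_mul {w : ℝ → ℝ} (hw : IntegrableOn w unitI) {x : ℝ} (hx : x ∈ unitI) :
    ∫ s in (0 : ℝ)..x, (x - s) * w s = ∫ s in (0 : ℝ)..x, ∫ r in (0 : ℝ)..s, w r := by
  simpa using integral_sub_pow_succ_mul hw 0 hx

theorem integral_sub_sq_mul {w : ℝ → ℝ} (hw : IntegrableOn w unitI) {x : ℝ} (hx : x ∈ unitI) :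
    ∫ s in (0 : ℝ)..x, (x - s) ^ 2 / 2 * w s =
      ∫ s in (0 : ℝ)..x, ∫ r in (0 : ℝ)..s, ∫ u in (0 : ℝ)..r, w u := by
  have h1 := integral_sub_pow_succ_mul hw 1 hx
  rw [← integral_sub_mul (continuousOn_primitive_unitI hw).integrableOn_unitI hx]
  have h2 : ∫ s in (0 : ℝ)..x, (x - s) ^ 2 / 2 * w s =
      (1 / 2) * ∫ s in (0 : ℝ)..x, (x - s) ^ 2 * w s := by
    rw [← intervalIntegral.integral_const_mul]
    congr 1; ext s; ring
  norm_num at h1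
  rw [h2, h1]; ring

/-- Replacing the upper limit by a truncated kernel. -/
theorem integral_truncated_pow_mul (w : ℝ → ℝ) {n : ℕ} (hn : n ≠ 0)
    {x : ℝ} (hx : x ∈ unitI) (hw : IntegrableOn w unitI) :
    ∫ s in (0 : ℝ)..1, (max (x - s) 0) ^ n * w s = ∫ s in (0 : ℝ)..x, (x - s) ^ n * w s := by
  have hk : ∀ y ∈ unitI, ∀ z ∈ unitI,
      IntervalIntegrable (fun s => (max (x - s) 0) ^ n * w s) volume y z := fun y hy z hz =>
    (intervalIntegrable_of_unitI hw hy hz).continuousOn_mul (by fun_prop)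
  rw [← intervalIntegral.integral_add_adjacent_intervals (hk 0 zero_mem_unitI x hx)
    (hk x hx 1 one_mem_unitI)]
  -- Beyond x the truncated base is 0; `n ≠ 0` excludes 0 ^ 0 = 1.
  have h2 : ∫ s in x..1, (max (x - s) 0) ^ n * w s = 0 := by
    rw [← intervalIntegral.integral_zero (a := x) (b := 1) (μ := volume)]
    refine intervalIntegral.integral_congr fun s hs => ?_
    rw [uIcc_of_le hx.2] at hs
    simp [max_eq_right (sub_nonpos.2 hs.1), hn]
  rw [h2, add_zero]
  refine intervalIntegral.integral_congr fun s hs => ?_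
  rw [uIcc_of_le hx.1] at hs
  simp [max_eq_left (sub_nonneg.2 hs.2)]

/-- At the corner the truncated power is bounded by |u|^(n+2) = o(u), which is why the exponent
starts at 2. Writing the kernels as polynomials plus truncated powers then avoids gluing their
branches at the knot. -/
theorem hasDerivAt_max_pow (n : ℕ) (u : ℝ) :
    HasDerivAt (fun u : ℝ => (max u 0) ^ (n + 2)) ((n + 2) * (max u 0) ^ (n + 1)) u := by
  rcases lt_trichotomy u 0 with hu | rfl | hu
  · have : (fun u : ℝ => (max u 0) ^ (n + 2)) =ᶠ[nhds u] fun _ => 0 := by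
      filter_upwards [Iio_mem_nhds hu] with v hv
      simp [max_eq_right (mem_Iio.1 hv).le]
    rw [max_eq_right hu.le]
    simpa using (hasDerivAt_const u (0 : ℝ)).congr_of_eventuallyEq this
  · rw [hasDerivAt_iff_isLittleO_nhds_zero]
    simp only [zero_add, max_self, ne_eq, Nat.add_eq_zero_iff, OfNat.ofNat_ne_zero, and_false,
      not_false_eq_true, zero_pow, sub_zero, one_ne_zero, mul_zero, smul_eq_mul]
    refine Asymptotics.IsBigO.trans_isLittleO (g := fun h : ℝ => h ^ (n + 2)) ?_
      (Asymptotics.isLittleO_pow_id (by omega))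
    refine Asymptotics.IsBigO.of_bound 1 (Filter.Eventually.of_forall fun h => ?_)
    simp only [norm_pow, Real.norm_eq_abs, one_mul]
    refine pow_le_pow_left₀ (abs_nonneg _) ?_ _
    rw [abs_of_nonneg (le_max_right _ _)]
    exact max_le (le_abs_self h) (abs_nonneg h)
  · have : (fun u : ℝ => (max u 0) ^ (n + 2)) =ᶠ[nhds u] fun u => u ^ (n + 2) := by
      filter_upwards [Ioi_mem_nhds hu] with v hv
      rw [max_eq_left (mem_Ioi.1 hv).le]
    rw [max_eq_left hu.le]
    simpa using (hasDerivAt_pow (n + 2) u).congr_of_eventuallyEq this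

/-! ### Membership in `W_2^{(3,2)}(D)` -/

theorem dXi_eqOn {y v : ℝ → ℝ → ℝ} {η : ℝ} (h : ∀ ξ ∈ unitI, y ξ η = v ξ η) :
    ∀ ξ ∈ unitI, dXi y ξ η = dXi v ξ η :=
  dI_congr h

theorem dEta_eqOn {y v : ℝ → ℝ → ℝ} {ξ : ℝ} (h : ∀ η ∈ unitI, y ξ η = v ξ η) :
    ∀ η ∈ unitI, dEta y ξ η = dEta v ξ η :=
  dI_congr h

theorem HasDXi.congr {y v : ℝ → ℝ → ℝ} {ξ η : ℝ} (hv : HasDXi v ξ η)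
    (h : ∀ ξ ∈ unitI, y ξ η = v ξ η) (hξ : ξ ∈ unitI) : HasDXi y ξ η :=
  DifferentiableWithinAt.congr hv h (h ξ hξ)

theorem HasDEta.congr {y v : ℝ → ℝ → ℝ} {ξ η : ℝ} (hv : HasDEta v ξ η)
    (h : ∀ η ∈ unitI, y ξ η = v ξ η) (hη : η ∈ unitI) : HasDEta y ξ η :=
  DifferentiableWithinAt.congr hv h (h η hη)

theorem AbsContOnD.congr {f g : ℝ → ℝ → ℝ} (hg : AbsContOnD g)
    (h : ∀ ξ ∈ unitI, ∀ η ∈ unitI, f ξ η = g ξ η) : AbsContOnD f := by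
  obtain ⟨a, b, c, ha, hb, hc, hg⟩ := hg
  refine ⟨a, b, c, ha, hb, hc, fun ξ hξ η hη => ?_⟩
  rw [h ξ hξ η hη, h 0 zero_mem_unitI 0 zero_mem_unitI, hg ξ hξ η hη]

theorem AbsContOnD.add {f g : ℝ → ℝ → ℝ} (hf : AbsContOnD f) (hg : AbsContOnD g) :
    AbsContOnD fun ξ η => f ξ η + g ξ η := by
  obtain ⟨a, b, c, ha, hb, hc, hf⟩ := hf
  obtain ⟨a', b', c', ha', hb', hc', hg⟩ := hg
  refine ⟨fun s => a s + a' s, fun s => b s + b' s, fun p => c p + c' p, ha.add ha', hb.add hb',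
    hc.add hc', fun ξ hξ η hη => ?_⟩
  have hsub : Icc 0 ξ ×ˢ Icc 0 η ⊆ unitD :=
    prod_mono (Icc_subset_Icc le_rfl hξ.2) (Icc_subset_Icc le_rfl hη.2)
  rw [intervalIntegral.integral_add (intervalIntegrable_of_unitI ha zero_mem_unitI hξ)
      (intervalIntegrable_of_unitI ha' zero_mem_unitI hξ),
    intervalIntegral.integral_add (intervalIntegrable_of_unitI hb zero_mem_unitI hη)
      (intervalIntegrable_of_unitI hb' zero_mem_unitI hη),
    integral_add (hc.mono_set hsub) (hc'.mono_set hsub)]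
  simp only [hf ξ hξ η hη, hg ξ hξ η hη]
  ring

/-- A product of two absolutely continuous functions of one variable is absolutely continuous
in the sense of Carathéodory. -/
theorem absContOnD_mul {f g w u : ℝ → ℝ} (hw : IntegrableOn w unitI) (hu : IntegrableOn u unitI)
    (hf : ∀ x ∈ unitI, f x = f 0 + ∫ s in (0 : ℝ)..x, w s)
    (hg : ∀ x ∈ unitI, g x = g 0 + ∫ s in (0 : ℝ)..x, u s) :
    AbsContOnD fun ξ η => f ξ * g η := by
  -- The densities come from expanding (f 0 + ∫w)(g 0 + ∫u).
  refine ⟨fun s => g 0 * w s, fun s => f 0 * u s, fun p => w p.1 * u p.2, hw.const_mul _,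
    hu.const_mul _, ?_, fun ξ hξ η hη => ?_⟩
  · rw [IntegrableOn, volume_restrict_unitD]
    exact Integrable.mul_prod hw hu
  · rw [Measure.volume_eq_prod, setIntegral_prod_mul, integral_Icc_eq_integral_Ioc,
      integral_Icc_eq_integral_Ioc, ← intervalIntegral.integral_of_le hξ.1,
      ← intervalIntegral.integral_of_le hη.1, intervalIntegral.integral_const_mul,
      intervalIntegral.integral_const_mul]
    simp only [hf ξ hξ, hg η hη]
    ring

/-- Membership in `W_2^{(3,2)}(D)` from explicit derivatives. -/
theorem MemW32.of_hasDerivWithinAt {y y₁ y₂ y₃ z₀ z₁ z₂ z₃ : ℝ → ℝ → ℝ}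
    (h₁ : ∀ ξ ∈ unitI, ∀ η ∈ unitI, HasDerivWithinAt (fun s => y ξ s) (y₁ ξ η) unitI η)
    (h₂ : ∀ ξ ∈ unitI, ∀ η ∈ unitI, HasDerivWithinAt (fun s => y₁ s η) (y₂ ξ η) unitI ξ)
    (h₃ : ∀ ξ ∈ unitI, ∀ η ∈ unitI, HasDerivWithinAt (fun s => y₂ s η) (y₃ ξ η) unitI ξ)
    (hac : AbsContOnD y₃)
    (hz : ∀ᵐ η ∂(volume.restrict unitI), ∀ ξ ∈ unitI,
      HasDerivWithinAt (fun s => y₁ ξ s) (z₀ ξ η) unitI η ∧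
      HasDerivWithinAt (fun s => z₀ s η) (z₁ ξ η) unitI ξ ∧
      HasDerivWithinAt (fun s => z₁ s η) (z₂ ξ η) unitI ξ)
    (hz₃ : ∀ᵐ ξ ∂(volume.restrict unitI), ∀ η ∈ unitI,
      HasDerivWithinAt (fun s => z₂ s η) (z₃ ξ η) unitI ξ)
    (hL2 : MemLp (fun p : ℝ × ℝ => z₃ p.1 p.2) 2 (volume.restrict unitD))
    (hi : ∀ ξ ∈ unitI, y ξ 0 = 0) (hl : ∀ η ∈ unitI, y 0 η = 0) (hr : ∀ η ∈ unitI, y 1 η = 0) :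
    MemW32 y := by
  have e₁ : ∀ ξ ∈ unitI, ∀ η ∈ unitI, dEta y ξ η = y₁ ξ η := fun ξ hξ η hη =>
    (h₁ ξ hξ η hη).dI_eq hη
  have e₂ : ∀ ξ ∈ unitI, ∀ η ∈ unitI, dXi (dEta y) ξ η = y₂ ξ η := fun ξ hξ η hη => by
    rw [dXi_eqOn (fun s hs => e₁ s hs η hη) ξ hξ]
    exact (h₂ ξ hξ η hη).dI_eq hξ
  have e₃ : ∀ ξ ∈ unitI, ∀ η ∈ unitI, dXi (dXi (dEta y)) ξ η = y₃ ξ η := fun ξ hξ η hη => by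
    rw [dXi_eqOn (fun s hs => e₂ s hs η hη) ξ hξ]
    exact (h₃ ξ hξ η hη).dI_eq hξ
  have hI : ∀ᵐ η ∂(volume.restrict unitI), η ∈ unitI := ae_restrict_mem measurableSet_unitI
  have key : ∀ᵐ η ∂(volume.restrict unitI), η ∈ unitI ∧ ∀ ξ ∈ unitI,
      HasDEta (dEta y) ξ η ∧ HasDXi (dEta (dEta y)) ξ η ∧ HasDXi (dXi (dEta (dEta y))) ξ η ∧
      dXi (dXi (dEta (dEta y))) ξ η = z₂ ξ η := by
    filter_upwards [hz, hI] with η hzη hη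
    have f₀ : ∀ ξ ∈ unitI, dEta (dEta y) ξ η = z₀ ξ η := fun ξ hξ => by
      rw [dEta_eqOn (e₁ ξ hξ) η hη]
      exact (hzη ξ hξ).1.dI_eq hη
    have f₁ : ∀ ξ ∈ unitI, dXi (dEta (dEta y)) ξ η = z₁ ξ η := fun ξ hξ => by
      rw [dXi_eqOn f₀ ξ hξ]
      exact (hzη ξ hξ).2.1.dI_eq hξ
    have f₂ : ∀ ξ ∈ unitI, dXi (dXi (dEta (dEta y))) ξ η = z₂ ξ η := fun ξ hξ => by
      rw [dXi_eqOn f₁ ξ hξ]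
      exact (hzη ξ hξ).2.2.dI_eq hξ
    exact ⟨hη, fun ξ hξ => ⟨HasDEta.congr (hzη ξ hξ).1.differentiableWithinAt (e₁ ξ hξ) hη,
      HasDXi.congr (hzη ξ hξ).2.1.differentiableWithinAt f₀ hξ,
      HasDXi.congr (hzη ξ hξ).2.2.differentiableWithinAt f₁ hξ, f₂ ξ hξ⟩⟩
  refine ⟨fun ξ hξ η hη => ⟨(h₁ ξ hξ η hη).differentiableWithinAt,
    HasDXi.congr (h₂ ξ hξ η hη).differentiableWithinAt (fun s hs => e₁ s hs η hη) hξ,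
    HasDXi.congr (h₃ ξ hξ η hη).differentiableWithinAt (fun s hs => e₂ s hs η hη) hξ⟩,
    hac.congr e₃, ?_, ?_, hi, hl, hr⟩
  · filter_upwards [key] with η hη
    refine ⟨fun ξ hξ => ⟨(hη.2 ξ hξ).1, (hη.2 ξ hξ).2.1, (hη.2 ξ hξ).2.2.1⟩, ?_⟩
    filter_upwards [hz₃, hI] with ξ hξ hξI
    exact HasDXi.congr (hξ η hη.1).differentiableWithinAt (fun s hs => (hη.2 s hs).2.2.2) hξI
  · refine (memLp_congr_ae ?_).2 hL2
    rw [volume_restrict_unitD]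
    -- Each exceptional set depends on one variable only, so its preimage under a projection is null
    -- in the square.
    filter_upwards [Measure.quasiMeasurePreserving_fst.ae (hz₃.and hI),
      Measure.quasiMeasurePreserving_snd.ae key] with p hp₁ hp₂
    rw [dXi_eqOn (fun s hs => (hp₂.2 s hs).2.2.2) p.1 hp₁.2]
    exact (hp₁.1 p.2 hp₂.1).dI_eq hp₁.2

/-- `f ∈ W_2^3[0,1]` with `f(0) = f(1) = 0`, together with its derivatives. -/
structure HasW3Derivs (f f₁ f₂ w : ℝ → ℝ) : Prop where
  memLp : MemLp w 2 (volume.restrict unitI)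
  deriv_one : ∀ x ∈ unitI, HasDerivWithinAt f (f₁ x) unitI x
  deriv_two : ∀ x ∈ unitI, HasDerivWithinAt f₁ (f₂ x) unitI x
  absCont : ∀ x ∈ unitI, f₂ x = f₂ 0 + ∫ s in (0 : ℝ)..x, w s
  left : f 0 = 0
  right : f 1 = 0

/-- `g ∈ W_2^2[0,1]` with `g(0) = 0`, together with its derivatives. -/
structure HasW2Derivs (g g₁ u : ℝ → ℝ) : Prop where
  memLp : MemLp u 2 (volume.restrict unitI)
  deriv_one : ∀ x ∈ unitI, HasDerivWithinAt g (g₁ x) unitI x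
  absCont : ∀ x ∈ unitI, g₁ x = g₁ 0 + ∫ s in (0 : ℝ)..x, u s
  left : g 0 = 0

theorem MemLp.integrableOn_unitI {w : ℝ → ℝ} (hw : MemLp w 2 (volume.restrict unitI)) :
    IntegrableOn w unitI := by
  have : IsFiniteMeasure ((volume : Measure ℝ).restrict unitI) := ⟨by simp [unitI]⟩
  exact hw.integrable one_le_two

theorem memLp_mul_unitD {w u : ℝ → ℝ} (hw : MemLp w 2 (volume.restrict unitI))
    (hu : MemLp u 2 (volume.restrict unitI)) :
    MemLp (fun p : ℝ × ℝ => w p.1 * u p.2) 2 (volume.restrict unitD) := by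
  have hm : AEStronglyMeasurable (fun p : ℝ × ℝ => w p.1 * u p.2)
      ((volume.restrict unitI).prod (volume.restrict unitI)) := hw.1.comp_fst.mul hu.1.comp_snd
  rw [volume_restrict_unitD, memLp_two_iff_integrable_sq hm]
  simp only [mul_pow]
  exact hw.integrable_sq.mul_prod hu.integrable_sq

theorem ae_hasDerivWithinAt_of_absCont {f w : ℝ → ℝ} (hw : IntegrableOn w unitI)
    (hf : ∀ x ∈ unitI, f x = f 0 + ∫ s in (0 : ℝ)..x, w s) :
    ∀ᵐ x ∂(volume.restrict unitI), HasDerivWithinAt f (w x) unitI x := by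
  filter_upwards [ae_hasDerivWithinAt_primitive hw, ae_restrict_mem measurableSet_unitI]
    with x hx hxI
  exact (hx.const_add (f 0)).congr hf (hf x hxI)

theorem HasW3Derivs.linear_combination {f f₁ f₂ w g g₁ g₂ u : ℝ → ℝ} (hf : HasW3Derivs f f₁ f₂ w)
    (hg : HasW3Derivs g g₁ g₂ u) (α β : ℝ) :
    HasW3Derivs (fun x => α * f x + β * g x) (fun x => α * f₁ x + β * g₁ x)
      (fun x => α * f₂ x + β * g₂ x) (fun x => α * w x + β * u x) where
  memLp := (hf.memLp.const_mul α).add (hg.memLp.const_mul β)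
  deriv_one x hx := ((hf.deriv_one x hx).const_mul α).add ((hg.deriv_one x hx).const_mul β)
  deriv_two x hx := ((hf.deriv_two x hx).const_mul α).add ((hg.deriv_two x hx).const_mul β)
  absCont x hx := by
    have hfi := intervalIntegrable_of_unitI (MemLp.integrableOn_unitI hf.memLp) zero_mem_unitI hx
    have hgi := intervalIntegrable_of_unitI (MemLp.integrableOn_unitI hg.memLp) zero_mem_unitI hx
    rw [intervalIntegral.integral_add (hfi.const_mul α) (hgi.const_mul β),
      intervalIntegral.integral_const_mul, intervalIntegral.integral_const_mul,
      hf.absCont x hx, hg.absCont x hx]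
    ring
  left := by simp [hf.left, hg.left]
  right := by simp [hf.right, hg.right]

/-- Two products are what ψ requires: one from the Caputo term, one from the three terms that
differentiate only in x. -/
theorem memW32_of_eq_mul_add_mul {y : ℝ → ℝ → ℝ} {f f₁ f₂ w g g₁ u f' f₁' f₂' w' g' g₁' u' : ℝ → ℝ}
    (hf : HasW3Derivs f f₁ f₂ w) (hg : HasW2Derivs g g₁ u)
    (hf' : HasW3Derivs f' f₁' f₂' w') (hg' : HasW2Derivs g' g₁' u')
    (h : ∀ ξ ∈ unitI, ∀ η ∈ unitI, y ξ η = f ξ * g η + f' ξ * g' η) : MemW32 y := by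
  have hwi := MemLp.integrableOn_unitI hf.memLp
  have hwi' := MemLp.integrableOn_unitI hf'.memLp
  have hui := MemLp.integrableOn_unitI hg.memLp
  have hui' := MemLp.integrableOn_unitI hg'.memLp
  refine MemW32.of_hasDerivWithinAt
    (y₁ := fun ξ η => f ξ * g₁ η + f' ξ * g₁' η) (y₂ := fun ξ η => f₁ ξ * g₁ η + f₁' ξ * g₁' η)
    (y₃ := fun ξ η => f₂ ξ * g₁ η + f₂' ξ * g₁' η) (z₀ := fun ξ η => f ξ * u η + f' ξ * u' η)
    (z₁ := fun ξ η => f₁ ξ * u η + f₁' ξ * u' η) (z₂ := fun ξ η => f₂ ξ * u η + f₂' ξ * u' η)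
    (z₃ := fun ξ η => w ξ * u η + w' ξ * u' η) ?_ ?_ ?_ ?_ ?_ ?_ ?_ ?_ ?_ ?_
  · intro ξ hξ η hη
    exact (((hg.deriv_one η hη).const_mul (f ξ)).add ((hg'.deriv_one η hη).const_mul (f' ξ))).congr
      (h ξ hξ) (h ξ hξ η hη)
  · intro ξ hξ η hη
    exact ((hf.deriv_one ξ hξ).mul_const (g₁ η)).add ((hf'.deriv_one ξ hξ).mul_const (g₁' η))
  · intro ξ hξ η hη
    exact ((hf.deriv_two ξ hξ).mul_const (g₁ η)).add ((hf'.deriv_two ξ hξ).mul_const (g₁' η))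
  · exact (absContOnD_mul hwi hui hf.absCont hg.absCont).add
      (absContOnD_mul hwi' hui' hf'.absCont hg'.absCont)
  · filter_upwards [ae_hasDerivWithinAt_of_absCont hui hg.absCont,
      ae_hasDerivWithinAt_of_absCont hui' hg'.absCont] with η h₁ h₂ ξ hξ
    exact ⟨(h₁.const_mul (f ξ)).add (h₂.const_mul (f' ξ)),
      ((hf.deriv_one ξ hξ).mul_const (u η)).add ((hf'.deriv_one ξ hξ).mul_const (u' η)),
      ((hf.deriv_two ξ hξ).mul_const (u η)).add ((hf'.deriv_two ξ hξ).mul_const (u' η))⟩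
  · filter_upwards [ae_hasDerivWithinAt_of_absCont hwi hf.absCont,
      ae_hasDerivWithinAt_of_absCont hwi' hf'.absCont] with ξ h₁ h₂ η _
    exact (h₁.mul_const (u η)).add (h₂.mul_const (u' η))
  · exact (memLp_mul_unitD hf.memLp hg.memLp).add (memLp_mul_unitD hf'.memLp hg'.memLp)
  · intro ξ hξ
    simp [h ξ hξ 0 zero_mem_unitI, hg.left, hg'.left]
  · intro η hη
    simp [h 0 zero_mem_unitI η hη, hf.left, hf'.left]
  · intro η hη
    simp [h 1 one_mem_unitI η hη, hf.right, hf'.right]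

/-! ### The kernel functions -/

theorem HasDerivAt.of_eq {f g : ℝ → ℝ} {f' g' x : ℝ} (h : HasDerivAt f f' x)
    (hfg : ∀ s, g s = f s) (hd : g' = f') : HasDerivAt g g' x := by
  rw [hd, funext hfg]
  exact h

theorem hasDerivAt_max_sub_pow (n : ℕ) (x ξ : ℝ) :
    HasDerivAt (fun ξ : ℝ => (max (ξ - x) 0) ^ (n + 2)) ((n + 2) * (max (ξ - x) 0) ^ (n + 1)) ξ := by
  exact ((hasDerivAt_max_pow n (ξ - x)).comp ξ ((hasDerivAt_id ξ).sub_const x)).of_eq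
    (fun _ => rfl) (by simp)

theorem hasDerivAt_max_sub_pow' (n : ℕ) (x ξ : ℝ) :
    HasDerivAt (fun x : ℝ => (max (ξ - x) 0) ^ (n + 2))
      (-((n + 2) * (max (ξ - x) 0) ^ (n + 1))) x := by
  exact ((hasDerivAt_max_pow n (ξ - x)).comp x ((hasDerivAt_id x).const_sub ξ)).of_eq
    (fun _ => rfl) (by simp)

/-- The polynomial parts of the kernels and of their derivatives have degree at most 5 in the
variable being differentiated. Supplying coefficients here reduces each differentiation to ring
identities. -/
theorem hasDerivAt_quintic (c₅ c₄ c₃ c₂ c₁ c₀ s : ℝ) :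
    HasDerivAt (fun s : ℝ => c₅ * s ^ 5 + c₄ * s ^ 4 + c₃ * s ^ 3 + c₂ * s ^ 2 + c₁ * s + c₀)
      (5 * c₅ * s ^ 4 + 4 * c₄ * s ^ 3 + 3 * c₃ * s ^ 2 + 2 * c₂ * s + c₁) s := by
  have h := (((((hasDerivAt_pow 5 s).const_mul c₅).add ((hasDerivAt_pow 4 s).const_mul c₄)).add
    ((hasDerivAt_pow 3 s).const_mul c₃)).add ((hasDerivAt_pow 2 s).const_mul c₂)).add
    (((hasDerivAt_id s).const_mul c₁)) |>.add_const c₀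
  refine h.of_eq (fun s => ?_) ?_
  · simp
  · push_cast; ring

theorem integral_indicator_Ioi {x ξ : ℝ} (hx : 0 ≤ x) (hξ : 0 ≤ ξ) :
    ∫ s in (0 : ℝ)..ξ, (Ioi x).indicator (fun _ => (1 : ℝ)) s = max (ξ - x) 0 := by
  rw [intervalIntegral.integral_of_le hξ, setIntegral_indicator measurableSet_Ioi,
    Ioc_inter_Ioi, setIntegral_const, Real.volume_real_Ioc, max_eq_right hx]
  simp

/-- The primitive kernel `∂_ξ³ R_x^{3}(ξ)`. -/
noncomputable def greenG (x ξ : ℝ) : ℝ := (max (x - ξ) 0) ^ 2 / 2 - x ^ 2 * ((1 - ξ) ^ 2 / 2)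

/-- The two branches differ by (ξ-x)⁵/120, so the kernel is C⁴ across the diagonal. -/
theorem R3_eq (x ξ : ℝ) : R3 x ξ = -(1 / 120) * (x - 1) * ξ * (ξ * x ^ 4 - 4 * ξ * x ^ 3
    + 6 * ξ * x ^ 2 + x * ξ ^ 4 - 5 * x * ξ ^ 3 - 120 * x * ξ + 120 * x + ξ ^ 4)
    - (max (ξ - x) 0) ^ 5 / 120 := by
  unfold R3
  split_ifs with h
  · rw [max_eq_right (by linarith)]; ring
  · rw [max_eq_left (by linarith)]; ring

theorem R2_eq (t η : ℝ) : R2 t η =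
    η * t + 1 / 2 * t * η ^ 2 - 1 / 6 * η ^ 3 + (max (η - t) 0) ^ 3 / 6 := by
  unfold R2
  split_ifs with h
  · rw [max_eq_right (by linarith)]; ring
  · rw [max_eq_left (by linarith)]; ring

/-- `∂_ξ R_x^{3}(ξ)`. -/
noncomputable def R3d₁ (x ξ : ℝ) : ℝ := -(1 / 120) * (x - 1) * (2 * ξ * (x ^ 4 - 4 * x ^ 3 + 6 * x ^ 2 - 120 * x)
  + 120 * x + 5 * (x + 1) * ξ ^ 4 - 20 * x * ξ ^ 3) - (max (ξ - x) 0) ^ 4 / 24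

/-- `∂_ξ² R_x^{3}(ξ)`. -/
noncomputable def R3d₂ (x ξ : ℝ) : ℝ := -(1 / 120) * (x - 1) * (2 * (x ^ 4 - 4 * x ^ 3 + 6 * x ^ 2 - 120 * x)
  + 20 * (x + 1) * ξ ^ 3 - 60 * x * ξ ^ 2) - (max (ξ - x) 0) ^ 3 / 6

theorem hasDerivAt_R3 (x ξ : ℝ) : HasDerivAt (R3 x) (R3d₁ x ξ) ξ := by
  have h := (hasDerivAt_quintic (-(1 / 120) * (x - 1) * (x + 1)) (-(1 / 120) * (x - 1) * (-5 * x)) 0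
    (-(1 / 120) * (x - 1) * (x ^ 4 - 4 * x ^ 3 + 6 * x ^ 2 - 120 * x))
    (-(1 / 120) * (x - 1) * (120 * x)) 0 ξ).sub ((hasDerivAt_max_sub_pow 3 x ξ).div_const 120)
  refine h.of_eq (fun s => ?_) ?_
  · rw [R3_eq]; simp only [Pi.sub_apply]; ring
  · rw [R3d₁]; push_cast; ring

theorem hasDerivAt_R3d₁ (x ξ : ℝ) : HasDerivAt (R3d₁ x) (R3d₂ x ξ) ξ := by
  have h := (hasDerivAt_quintic 0 (-(1 / 120) * (x - 1) * (5 * (x + 1)))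
    (-(1 / 120) * (x - 1) * (-20 * x)) 0
    (-(1 / 120) * (x - 1) * (2 * (x ^ 4 - 4 * x ^ 3 + 6 * x ^ 2 - 120 * x)))
    (-(1 / 120) * (x - 1) * (120 * x)) ξ).sub ((hasDerivAt_max_sub_pow 2 x ξ).div_const 24)
  refine h.of_eq (fun s => ?_) ?_
  · rw [R3d₁]; simp only [Pi.sub_apply]; ring
  · rw [R3d₂]; push_cast; ring

/-- This is the reason R3 reproduces: its third derivative is the kernel that recovers a function
vanishing at 0 and 1 from its own third derivative, up to the multiple x(1-x) of its slope at 0. -/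
theorem hasDerivAt_R3d₂ (x ξ : ℝ) : HasDerivAt (R3d₂ x) (greenG x ξ) ξ := by
  have h := (hasDerivAt_quintic 0 0 (-(1 / 120) * (x - 1) * (20 * (x + 1)))
    (-(1 / 120) * (x - 1) * (-60 * x)) 0
    (-(1 / 120) * (x - 1) * (2 * (x ^ 4 - 4 * x ^ 3 + 6 * x ^ 2 - 120 * x)))
    ξ).sub ((hasDerivAt_max_sub_pow 1 x ξ).div_const 6)
  refine h.of_eq (fun s => ?_) ?_
  · rw [R3d₂]; simp only [Pi.sub_apply]; ring
  · rw [greenG]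
    push_cast
    rcases le_total ξ x with hx | hx
    · rw [max_eq_left (by linarith : 0 ≤ x - ξ), max_eq_right (by linarith : ξ - x ≤ 0)]; ring
    · rw [max_eq_right (by linarith : x - ξ ≤ 0), max_eq_left (by linarith : 0 ≤ ξ - x)]; ring

theorem continuous_greenG (x : ℝ) : Continuous (greenG x) := by
  unfold greenG; fun_prop

theorem memLp_of_continuousOn {w : ℝ → ℝ} (hw : ContinuousOn w unitI) :
    MemLp w 2 (volume.restrict unitI) := by
  obtain ⟨C, hC⟩ := isCompact_Icc.exists_bound_of_continuousOn hw
  have : IsFiniteMeasure ((volume : Measure ℝ).restrict unitI) := ⟨by simp [unitI]⟩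
  exact MemLp.of_bound (hw.aestronglyMeasurable measurableSet_unitI) C
    (ae_restrict_of_forall_mem measurableSet_unitI hC)

theorem HasW3Derivs.of_hasDerivAt {f f₁ f₂ w : ℝ → ℝ} (h₁ : ∀ x, HasDerivAt f (f₁ x) x)
    (h₂ : ∀ x, HasDerivAt f₁ (f₂ x) x) (h₃ : ∀ x, HasDerivAt f₂ (w x) x) (hw : Continuous w)
    (hl : f 0 = 0) (hr : f 1 = 0) : HasW3Derivs f f₁ f₂ w where
  memLp := memLp_of_continuousOn hw.continuousOn
  deriv_one x _ := (h₁ x).hasDerivWithinAt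
  deriv_two x _ := (h₂ x).hasDerivWithinAt
  absCont _ hx := eq_add_integral_of_hasDerivWithinAt (fun x _ => (h₃ x).hasDerivWithinAt)
    hw.continuousOn hx
  left := hl
  right := hr

theorem R3_zero {x : ℝ} (hx : x ∈ unitI) : R3 x 0 = 0 := by
  rw [R3, if_pos hx.1]; ring

theorem R3_one {x : ℝ} (hx : x ∈ unitI) : R3 x 1 = 0 := by
  rw [R3_eq, max_eq_left (by linarith [hx.2])]; ring

theorem hasW3Derivs_R3 {x : ℝ} (hx : x ∈ unitI) :
    HasW3Derivs (R3 x) (R3d₁ x) (R3d₂ x) (greenG x) :=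
  .of_hasDerivAt (hasDerivAt_R3 x) (hasDerivAt_R3d₁ x) (hasDerivAt_R3d₂ x)
    (continuous_greenG x) (R3_zero hx) (R3_one hx)

/-! ### Derivatives of the spatial kernel in its parameter x -/

/-- `∂_x R_x^{3}(ξ)`. -/
noncomputable def R3x (x ξ : ℝ) : ℝ := -(1 / 120) * ((2 * x) * ξ ^ 5 + (5 - 10 * x) * ξ ^ 4
  + (5 * x ^ 4 - 20 * x ^ 3 + 30 * x ^ 2 - 252 * x + 120) * ξ ^ 2 + (240 * x - 120) * ξ)
  + (max (ξ - x) 0) ^ 4 / 24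

/-- `∂_x² R_x^{3}(ξ)`. -/
noncomputable def R3xx (x ξ : ℝ) : ℝ := -(1 / 120) * (2 * ξ ^ 5 - 10 * ξ ^ 4
  + (20 * x ^ 3 - 60 * x ^ 2 + 60 * x - 252) * ξ ^ 2 + 240 * ξ)
  - (max (ξ - x) 0) ^ 3 / 6

theorem hasDerivAt_R3_left (x ξ : ℝ) : HasDerivAt (fun x => R3 x ξ) (R3x x ξ) x := by
  have h := (hasDerivAt_quintic (-(1 / 120) * ξ ^ 2) (-(1 / 120) * (-5 * ξ ^ 2))
    (-(1 / 120) * (10 * ξ ^ 2))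
    (-(1 / 120) * ξ * (ξ ^ 4 - 5 * ξ ^ 3 - 126 * ξ + 120))
    (-(1 / 120) * ξ * (5 * ξ ^ 3 + 120 * ξ - 120)) (1 / 120 * ξ ^ 5) x).sub
    ((hasDerivAt_max_sub_pow' 3 x ξ).div_const 120)
  refine h.of_eq (fun s => ?_) ?_
  · rw [R3_eq]; simp only [Pi.sub_apply]; ring
  · rw [R3x]; push_cast; ring

theorem hasDerivAt_R3x_left (x ξ : ℝ) : HasDerivAt (fun x => R3x x ξ) (R3xx x ξ) x := by
  have h := (hasDerivAt_quintic 0 (-(1 / 120) * (5 * ξ ^ 2)) (-(1 / 120) * (-20 * ξ ^ 2))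
    (-(1 / 120) * (30 * ξ ^ 2))
    (-(1 / 120) * (2 * ξ ^ 5 - 10 * ξ ^ 4 - 252 * ξ ^ 2 + 240 * ξ))
    (-(1 / 120) * (5 * ξ ^ 4 + 120 * ξ ^ 2 - 120 * ξ)) x).add
    ((hasDerivAt_max_sub_pow' 2 x ξ).div_const 24)
  refine h.of_eq (fun s => ?_) ?_
  · rw [R3x]; simp only [Pi.add_apply]; ring
  · rw [R3xx]; push_cast; ring

/-- One x-derivative leaves the truncated power (ξ-x)₊⁴/24, whose third ξ-derivative (ξ-x)₊ is still
continuous. -/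
theorem exists_hasW3Derivs_R3x {x : ℝ} (hx : x ∈ unitI) :
    ∃ f₁ f₂ w, HasW3Derivs (R3x x) f₁ f₂ w := by
  set c := 5 * x ^ 4 - 20 * x ^ 3 + 30 * x ^ 2 - 252 * x + 120 with hc
  refine ⟨fun ξ => -(1 / 120) * ((10 * x) * ξ ^ 4 + (20 - 40 * x) * ξ ^ 3 + 2 * c * ξ
      + (240 * x - 120)) + (max (ξ - x) 0) ^ 3 / 6,
    fun ξ => -(1 / 120) * ((40 * x) * ξ ^ 3 + (60 - 120 * x) * ξ ^ 2 + 2 * c)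
      + (max (ξ - x) 0) ^ 2 / 2,
    fun ξ => -(1 / 120) * ((120 * x) * ξ ^ 2 + (120 - 240 * x) * ξ) + max (ξ - x) 0,
    .of_hasDerivAt (fun ξ => ?_) (fun ξ => ?_) (fun ξ => ?_) (by fun_prop) ?_ ?_⟩
  · have h := (hasDerivAt_quintic (-(1 / 120) * (2 * x)) (-(1 / 120) * (5 - 10 * x)) 0
      (-(1 / 120) * c) (-(1 / 120) * (240 * x - 120)) 0 ξ).add
      ((hasDerivAt_max_sub_pow 2 x ξ).div_const 24)
    refine h.of_eq (fun s => ?_) ?_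
    · rw [R3x]; simp only [Pi.add_apply]; ring
    · push_cast; ring
  · have h := (hasDerivAt_quintic 0 (-(1 / 120) * (10 * x)) (-(1 / 120) * (20 - 40 * x)) 0
      (-(1 / 120) * (2 * c)) (-(1 / 120) * (240 * x - 120)) ξ).add
      ((hasDerivAt_max_sub_pow 1 x ξ).div_const 6)
    refine h.of_eq (fun s => ?_) ?_
    · simp only [Pi.add_apply]; ring
    · push_cast; ring
  · have h := (hasDerivAt_quintic 0 0 (-(1 / 120) * (40 * x)) (-(1 / 120) * (60 - 120 * x)) 0
      (-(1 / 120) * (2 * c)) ξ).add ((hasDerivAt_max_sub_pow 0 x ξ).div_const 2)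
    refine h.of_eq (fun s => ?_) ?_
    · simp only [Pi.add_apply]; ring
    · push_cast; ring
  · rw [R3x, max_eq_right (by linarith [hx.1])]; ring
  · rw [R3x, max_eq_left (by linarith [hx.2])]; ring

theorem memLp_indicator_Ioi (x : ℝ) :
    MemLp ((Ioi x).indicator fun _ => (1 : ℝ)) 2 (volume.restrict unitI) :=
  (memLp_of_continuousOn continuousOn_const).indicator measurableSet_Ioi

/-- Two x-derivatives leave (ξ-x)₊³/6, whose third ξ-derivative is a jump at x. It is in L², but the
second ξ-derivative is only absolutely continuous, so that step is an explicit integral. -/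
theorem exists_hasW3Derivs_R3xx {x : ℝ} (hx : x ∈ unitI) :
    ∃ f₁ f₂ w, HasW3Derivs (R3xx x) f₁ f₂ w := by
  set c := 20 * x ^ 3 - 60 * x ^ 2 + 60 * x - 252 with hc
  have hL := memLp_indicator_Ioi x
  refine ⟨fun ξ => -(1 / 120) * (10 * ξ ^ 4 - 40 * ξ ^ 3 + 2 * c * ξ + 240)
      - (max (ξ - x) 0) ^ 2 / 2,
    fun ξ => -(1 / 120) * (40 * ξ ^ 3 - 120 * ξ ^ 2 + 2 * c) - max (ξ - x) 0,
    fun ξ => (2 * ξ - ξ ^ 2) - (Ioi x).indicator (fun _ => 1) ξ,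
    ⟨(memLp_of_continuousOn (by fun_prop)).sub hL, fun ξ _ => HasDerivAt.hasDerivWithinAt ?_,
      fun ξ _ => HasDerivAt.hasDerivWithinAt ?_, fun ξ hξ => ?_, ?_, ?_⟩⟩
  · have h := (hasDerivAt_quintic (-(1 / 120) * 2) (-(1 / 120) * (-10)) 0
      (-(1 / 120) * c) (-(1 / 120) * 240) 0 ξ).sub ((hasDerivAt_max_sub_pow 1 x ξ).div_const 6)
    refine h.of_eq (fun s => ?_) ?_
    · rw [R3xx]; simp only [Pi.sub_apply]; ring
    · push_cast; ring
  · have h := (hasDerivAt_quintic 0 (-(1 / 120) * 10) (-(1 / 120) * (-40)) 0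
      (-(1 / 120) * (2 * c)) (-(1 / 120) * 240) ξ).sub
      ((hasDerivAt_max_sub_pow 0 x ξ).div_const 2)
    refine h.of_eq (fun s => ?_) ?_
    · simp only [Pi.sub_apply]; ring
    · push_cast; ring
  · rw [intervalIntegral.integral_sub (Continuous.intervalIntegrable (by fun_prop) _ _)
      (intervalIntegrable_of_unitI (MemLp.integrableOn_unitI hL) zero_mem_unitI hξ),
      integral_indicator_Ioi hx.1 hξ.1, intervalIntegral.integral_sub
      (Continuous.intervalIntegrable (by fun_prop) _ _)
      (Continuous.intervalIntegrable (by fun_prop) _ _), intervalIntegral.integral_const_mul,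
      integral_id, integral_pow, max_eq_right (by linarith [hx.1] : 0 - x ≤ 0)]
    push_cast
    ring
  · rw [R3xx, max_eq_right (by linarith [hx.1])]; ring
  · rw [R3xx, max_eq_left (by linarith [hx.2])]; ring

/-! ### The temporal kernel and its derivative in the parameter t -/

/-- `∂_η R_t^{2}(η)`. -/
noncomputable def R2d₁ (t η : ℝ) : ℝ := t + t * η - η ^ 2 / 2 + (max (η - t) 0) ^ 2 / 2

theorem hasDerivAt_R2 (t η : ℝ) : HasDerivAt (R2 t) (R2d₁ t η) η := by
  have h := (hasDerivAt_quintic 0 0 (-1 / 6) (1 / 2 * t) t 0 η).add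
    ((hasDerivAt_max_sub_pow 1 t η).div_const 6)
  refine h.of_eq (fun s => ?_) ?_
  · rw [R2_eq]; simp only [Pi.add_apply]; ring
  · rw [R2d₁]; push_cast; ring

theorem hasDerivAt_R2d₁ (t η : ℝ) : HasDerivAt (R2d₁ t) (max (t - η) 0) η := by
  have h := (hasDerivAt_quintic 0 0 0 (-1 / 2) t t η).add
    ((hasDerivAt_max_sub_pow 0 t η).div_const 2)
  refine h.of_eq (fun s => ?_) ?_
  · rw [R2d₁]; simp only [Pi.add_apply]; ring
  · push_cast
    rcases le_total η t with ht | ht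
    · rw [max_eq_left (by linarith : 0 ≤ t - η), max_eq_right (by linarith : η - t ≤ 0)]; ring
    · rw [max_eq_right (by linarith : t - η ≤ 0), max_eq_left (by linarith : 0 ≤ η - t)]; ring

theorem R2_zero {t : ℝ} (ht : t ∈ unitI) : R2 t 0 = 0 := by
  rw [R2, if_pos ht.1]; ring

theorem hasW2Derivs_R2 {t : ℝ} (ht : t ∈ unitI) :
    HasW2Derivs (R2 t) (R2d₁ t) fun η => max (t - η) 0 where
  memLp := memLp_of_continuousOn (by fun_prop)
  deriv_one η _ := (hasDerivAt_R2 t η).hasDerivWithinAt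
  absCont _ hη := eq_add_integral_of_hasDerivWithinAt
    (fun η _ => (hasDerivAt_R2d₁ t η).hasDerivWithinAt) (by fun_prop) hη
  left := R2_zero ht

/-- `∂_t R_t^{2}(η)`. -/
noncomputable def R2t (t η : ℝ) : ℝ := η + η ^ 2 / 2 - (max (η - t) 0) ^ 2 / 2

theorem hasDerivAt_R2_left (t η : ℝ) : HasDerivAt (fun t => R2 t η) (R2t t η) t := by
  have h := (hasDerivAt_quintic 0 0 0 0 (η + 1 / 2 * η ^ 2) (-1 / 6 * η ^ 3) t).add
    ((hasDerivAt_max_sub_pow' 1 t η).div_const 6)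
  refine h.of_eq (fun s => ?_) ?_
  · rw [R2_eq]; simp only [Pi.add_apply]; ring
  · rw [R2t]; push_cast; ring

theorem hasDerivAt_R2t (t η : ℝ) : HasDerivAt (R2t t) (1 + η - max (η - t) 0) η := by
  have h := (hasDerivAt_quintic 0 0 0 (1 / 2) 1 0 η).sub
    ((hasDerivAt_max_sub_pow 0 t η).div_const 2)
  refine h.of_eq (fun s => ?_) ?_
  · rw [R2t]; simp only [Pi.sub_apply]; ring
  · push_cast; ring

theorem R2t_zero {t : ℝ} (ht : t ∈ unitI) : R2t t 0 = 0 := by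
  rw [R2t, max_eq_right (by linarith [ht.1])]; ring

theorem one_add_sub_max_eq {t η : ℝ} (ht : t ∈ unitI) (hη : η ∈ unitI) :
    1 + η - max (η - t) 0 =
      1 + ∫ s in (0 : ℝ)..η, (1 - (Ioi t).indicator (fun _ => (1 : ℝ)) s) := by
  rw [intervalIntegral.integral_sub intervalIntegrable_const
    (intervalIntegrable_of_unitI (MemLp.integrableOn_unitI (memLp_indicator_Ioi t))
      zero_mem_unitI hη), integral_indicator_Ioi ht.1 hη.1]
  simp
  ring

theorem hasW2Derivs_R2t {t : ℝ} (ht : t ∈ unitI) :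
    HasW2Derivs (R2t t) (fun η => 1 + η - max (η - t) 0)
      fun η => 1 - (Ioi t).indicator (fun _ => 1) η where
  memLp := (memLp_of_continuousOn continuousOn_const).sub (memLp_indicator_Ioi t)
  deriv_one η _ := (hasDerivAt_R2t t η).hasDerivWithinAt
  absCont η hη := by
    rw [one_add_sub_max_eq ht hη, max_eq_right (by linarith [ht.1] : 0 - t ≤ 0)]
    ring
  left := R2t_zero ht

/-! ### The kernel and the functions `ψ` belong to the space -/

theorem memW32_kernelK {x t : ℝ} (hx : x ∈ unitI) (ht : t ∈ unitI) : MemW32 (kernelK x t) := by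
  refine memW32_of_eq_mul_add_mul (hasW3Derivs_R3 hx) (hasW2Derivs_R2 ht)
    -- The second product is made zero by the coefficients 0, 0.
    ((hasW3Derivs_R3 hx).linear_combination (hasW3Derivs_R3 hx) 0 0) (hasW2Derivs_R2 ht)
    fun ξ _ η _ => ?_
  simp [kernelK]

/-! ### The Caputo derivative of the temporal kernel -/

/-- Weighted averages over `r` of primitives, with a bounded measurable integrand. -/
theorem integral_mul_primitive_swap {κ : ℝ → ℝ} {F : ℝ → ℝ → ℝ} {t η C : ℝ}
    (hκ : IntervalIntegrable κ volume 0 t) (hF : Measurable (Function.uncurry F))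
    (hC : ∀ r ∈ uIoc 0 t, ∀ s ∈ uIoc 0 η, ‖F r s‖ ≤ C) :
    ∫ r in (0 : ℝ)..t, κ r * ∫ s in (0 : ℝ)..η, F r s =
      ∫ s in (0 : ℝ)..η, ∫ r in (0 : ℝ)..t, κ r * F r s := by
  have hint : IntegrableOn (Function.uncurry fun r s => κ r * F r s)
      (uIoc 0 t ×ˢ uIoc 0 η) := by
    rw [IntegrableOn, Measure.volume_eq_prod, ← Measure.prod_restrict]
    have : IsFiniteMeasure ((volume : Measure ℝ).restrict (uIoc 0 η)) := ⟨by simp [uIoc]⟩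
    refine Integrable.mul_bdd (c := C) ((intervalIntegrable_iff.1 hκ).comp_fst _)
      hF.aestronglyMeasurable ?_
    rw [Measure.prod_restrict]
    exact ae_restrict_of_forall_mem (measurableSet_uIoc.prod measurableSet_uIoc)
      fun p hp => hC p.1 hp.1 p.2 hp.2
  rw [← intervalIntegral_intervalIntegral_swap hint]
  simp only [intervalIntegral.integral_const_mul]

/-- Instead of differentiating under the integral, each integrand is written as a primitive in η and
the integrals are exchanged, so integrability of κ suffices. The last density is bounded by ∫|κ|,
hence in L² even when κ is not. -/
theorem hasW2Derivs_integral_R2t {κ : ℝ → ℝ} {t : ℝ} (ht : t ∈ unitI)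
    (hκ : IntervalIntegrable κ volume 0 t) :
    HasW2Derivs (fun η => ∫ r in (0 : ℝ)..t, κ r * R2t r η)
      (fun η => ∫ r in (0 : ℝ)..t, κ r * (1 + η - max (η - r) 0))
      (fun η => ∫ r in (0 : ℝ)..t, κ r * (1 - (Ioi r).indicator (fun _ => 1) η)) := by
  have hr : ∀ r ∈ uIcc 0 t, r ∈ unitI := fun r hr =>
    ordConnected_Icc.uIcc_subset zero_mem_unitI ht hr
  have hind : Measurable (Function.uncurry fun r η : ℝ =>
      1 - (Ioi r).indicator (fun _ => (1 : ℝ)) η) := by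
    have : (Function.uncurry fun r η : ℝ => 1 - (Ioi r).indicator (fun _ => (1 : ℝ)) η) =
        fun p => 1 - {p : ℝ × ℝ | p.1 < p.2}.indicator (fun _ => (1 : ℝ)) p := by
      ext p
      simp [Function.uncurry, indicator]
    rw [this]
    exact measurable_const.sub
      (measurable_const.indicator (measurableSet_lt measurable_fst measurable_snd))
  have hind_le : ∀ r η : ℝ, ‖1 - (Ioi r).indicator (fun _ => (1 : ℝ)) η‖ ≤ 1 := by
    intro r η
    by_cases h : η ∈ Ioi r <;> simp [h]
  have hAC : ∀ η ∈ unitI, ∫ r in (0 : ℝ)..t, κ r * (1 + η - max (η - r) 0) =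
      (∫ r in (0 : ℝ)..t, κ r * (1 + 0 - max (0 - r) 0)) +
      ∫ s in (0 : ℝ)..η, ∫ r in (0 : ℝ)..t, κ r * (1 - (Ioi r).indicator (fun _ => 1) s) := by
    intro η hη
    rw [← integral_mul_primitive_swap hκ hind (fun r _ s _ => hind_le r s),
      ← intervalIntegral.integral_add]
    · refine intervalIntegral.integral_congr fun r hrt => ?_
      simp only [one_add_sub_max_eq (hr r hrt) hη, max_eq_right (by linarith [(hr r hrt).1] :
        0 - r ≤ 0)]
      ring
    · exact hκ.mul_continuousOn (by fun_prop)
    · have : ∀ r ∈ uIcc 0 t, (∫ s in (0 : ℝ)..η, (1 - (Ioi r).indicator (fun _ => (1 : ℝ)) s)) =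
          η - max (η - r) 0 := fun r hrt => by linarith [one_add_sub_max_eq (hr r hrt) hη]
      refine IntervalIntegrable.congr (f := fun r => κ r * (η - max (η - r) 0)) ?_ ?_
      · exact fun r hrt => by simp only [this r (uIoc_subset_uIcc hrt)]
      · exact hκ.mul_continuousOn (by fun_prop)
  have hmeas : AEStronglyMeasurable
      (fun η => ∫ r in (0 : ℝ)..t, κ r * (1 - (Ioi r).indicator (fun _ => 1) η))
      (volume.restrict unitI) := by
    simp only [intervalIntegral.integral_of_le ht.1]
    have h₁ : AEStronglyMeasurable (fun p : ℝ × ℝ => κ p.2 *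
        (1 - (Ioi p.2).indicator (fun _ => (1 : ℝ)) p.1))
        ((volume.restrict unitI).prod (volume.restrict (Ioc 0 t))) :=
      (hκ.1.aestronglyMeasurable.comp_snd).mul
        (hind.comp measurable_swap).aestronglyMeasurable
    exact h₁.integral_prod_right'
  have hfin : IsFiniteMeasure ((volume : Measure ℝ).restrict unitI) := ⟨by simp [unitI]⟩
  have hLp : MemLp (fun η => ∫ r in (0 : ℝ)..t, κ r * (1 - (Ioi r).indicator (fun _ => 1) η)) 2
      (volume.restrict unitI) := by
    refine MemLp.of_bound hmeas (∫ r in (0 : ℝ)..t, ‖κ r‖) (Filter.Eventually.of_forall fun η => ?_)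
    refine intervalIntegral.norm_integral_le_of_norm_le ht.1
      (Filter.Eventually.of_forall fun r _ => ?_) hκ.norm
    rw [norm_mul]
    exact mul_le_of_le_one_right (norm_nonneg _) (hind_le r η)
  refine ⟨hLp, fun η hη => ?_, hAC, ?_⟩
  · have hcont : ContinuousOn (fun η => ∫ r in (0 : ℝ)..t, κ r * (1 + η - max (η - r) 0))
        unitI :=
      ((continuousOn_primitive_unitI (MemLp.integrableOn_unitI hLp)).const_add _).congr hAC
    refine (hasDerivWithinAt_primitive hcont hη).congr_of_mem (fun η hη => ?_) hη
    -- For r, s in [0,1] the quantity 1 + s - (s-r)₊ lies between 0 and 2.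
    rw [← integral_mul_primitive_swap (C := 2) hκ (by fun_prop)]
    · refine intervalIntegral.integral_congr fun r hrt => ?_
      have := eq_add_integral_of_hasDerivWithinAt (f := R2t r)
        (fun η _ => (hasDerivAt_R2t r η).hasDerivWithinAt) (by fun_prop) hη
      simp only [this, R2t_zero (hr r hrt), zero_add]
    · intro r hrt s hs
      have h₁ := hr r (uIoc_subset_uIcc hrt)
      have h₂ := uIoc_subset_unitI zero_mem_unitI hη hs
      rw [Real.norm_eq_abs, abs_le]
      constructor <;> rcases max_cases (s - r) 0 with h | h <;>
        linarith [h₁.1, h₁.2, h₂.1, h₂.2, h.1]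
  · have : ∀ r ∈ uIcc 0 t, κ r * R2t r 0 = 0 := fun r hrt => by rw [R2t_zero (hr r hrt), mul_zero]
    rw [intervalIntegral.integral_congr this]
    simp

/-- The factor c is quantified after g because in ψ it is R3 x ξ, which varies with ξ while g must
not. -/
theorem exists_hasW2Derivs_caputo_R2 {α t : ℝ} (hα : α ≤ 1) (ht : t ∈ unitI) :
    ∃ g g₁ u, HasW2Derivs g g₁ u ∧ ∀ c, ∀ η ∈ unitI, caputo α (fun s => c * R2 s η) t = c * g η := by
  have hd : ∀ c η, ∀ r ∈ unitI, dI (fun s => c * R2 s η) r = c * R2t r η := fun c η r hr =>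
    ((hasDerivAt_R2_left r η).const_mul c).hasDerivWithinAt.dI_eq hr
  rcases eq_or_ne α 1 with rfl | hα'
  · refine ⟨_, _, _, hasW2Derivs_R2t ht, fun c η _ => ?_⟩
    rw [caputo, if_pos rfl, hd c η t ht]
  · have hα₁ : α < 1 := lt_of_le_of_ne hα hα'
    have hκ : IntervalIntegrable (fun r => 1 / Real.Gamma (1 - α) * ((t - r) ^ α)⁻¹) volume 0 t := by
      -- The singular weight is the reflection of r^(-α), integrable since α < 1.
      have h₁ : IntervalIntegrable (fun r : ℝ => r ^ (-α)) volume 0 t :=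
        intervalIntegral.intervalIntegrable_rpow' (by linarith)
      have h₂ := (h₁.comp_sub_left t).symm
      rw [sub_zero, sub_self] at h₂
      refine (IntervalIntegrable.congr ?_ h₂).const_mul _
      intro r hr
      rw [uIoc_of_le ht.1] at hr
      exact Real.rpow_neg (sub_nonneg.2 hr.2) α
    refine ⟨_, _, _, hasW2Derivs_integral_R2t ht hκ, fun c η _ => ?_⟩
    rw [caputo, if_neg hα', ← intervalIntegral.integral_const_mul,
      ← intervalIntegral.integral_const_mul]
    refine intervalIntegral.integral_congr fun r hr => ?_
    simp only [hd c η r (ordConnected_Icc.uIcc_subset zero_mem_unitI ht hr)]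
    ring

/-- L acts on the parameters, so its coefficients are frozen at (x,t) and ψ = R_x·g + (k₁∂_x²R_x +
k₂R_x + k₃∂_xR_x)·R_t, with g the Caputo derivative of R_t in t. -/
theorem memW32_psi {α : ℝ} (hα : α ≤ 1) (k₁ k₂ k₃ : ℝ → ℝ → ℝ) {x t : ℝ} (hx : x ∈ unitI)
    (ht : t ∈ unitI) : MemW32 (psi α k₁ k₂ k₃ kernelK x t) := by
  obtain ⟨g, g₁, u, hg, hcap⟩ := exists_hasW2Derivs_caputo_R2 hα ht
  obtain ⟨a₁, a₂, a₃, ha⟩ := exists_hasW3Derivs_R3x hx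
  obtain ⟨b₁, b₂, b₃, hb⟩ := exists_hasW3Derivs_R3xx hx
  have h3 := hasW3Derivs_R3 hx
  refine memW32_of_eq_mul_add_mul h3 hg ((hb.linear_combination h3 (k₁ x t) (k₂ x t)).linear_combination
    ha 1 (k₃ x t)) (hasW2Derivs_R2 ht) fun ξ hξ η hη => ?_
  have d₁ : ∀ s ∈ unitI, dXi (fun x t => kernelK x t ξ η) s t = R3x s ξ * R2 t η := fun s hs =>
    ((hasDerivAt_R3_left s ξ).mul_const (R2 t η)).hasDerivWithinAt.dI_eq hs
  have d₂ : dXi (dXi fun x t => kernelK x t ξ η) x t = R3xx x ξ * R2 t η := by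
    rw [dXi_eqOn (v := fun s t => R3x s ξ * R2 t η) d₁ x hx]
    exact ((hasDerivAt_R3x_left x ξ).mul_const (R2 t η)).hasDerivWithinAt.dI_eq hx
  have hc : caputo α (fun s => kernelK x s ξ η) t = R3 x ξ * g η := hcap (R3 x ξ) η hη
  simp only [psi, opL, d₁ x hx, d₂, hc]
  simp only [kernelK]
  ring

/-! ### Integral representation of the elements of the space -/

/-- The truncated square in G yields the triple primitive of w at x by Cauchy's formula; the other
term is x² times the same remainder at 1. -/
theorem integral_greenG_mul {w : ℝ → ℝ} (hw : IntegrableOn w unitI) {x : ℝ} (hx : x ∈ unitI) :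
    ∫ s in (0 : ℝ)..1, greenG x s * w s =
      (∫ s in (0 : ℝ)..x, ∫ r in (0 : ℝ)..s, ∫ u in (0 : ℝ)..r, w u) -
        x ^ 2 * ∫ s in (0 : ℝ)..1, (1 - s) ^ 2 / 2 * w s := by
  have hi := intervalIntegrable_of_unitI hw zero_mem_unitI one_mem_unitI
  have h₁ : ∫ s in (0 : ℝ)..1, greenG x s * w s =
      (∫ s in (0 : ℝ)..1, (1 / 2) * ((max (x - s) 0) ^ 2 * w s)) -
        ∫ s in (0 : ℝ)..1, x ^ 2 * ((1 - s) ^ 2 / 2 * w s) := by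
    rw [← intervalIntegral.integral_sub ((hi.continuousOn_mul (by fun_prop)).const_mul _)
      ((hi.continuousOn_mul (by fun_prop)).const_mul _)]
    congr 1; ext s; rw [greenG]; ring
  rw [h₁, intervalIntegral.integral_const_mul, intervalIntegral.integral_const_mul,
    integral_truncated_pow_mul w two_ne_zero hx hw, ← integral_sub_sq_mul hw hx,
    ← intervalIntegral.integral_const_mul]
  congr 2; ext s; ring

/-- Taylor's formula with integral remainder for `W_2^3` type functions. -/
theorem taylor_unitI {g g₁ g₂ w : ℝ → ℝ} (hw : IntegrableOn w unitI)
    (h₁ : ∀ x ∈ unitI, HasDerivWithinAt g (g₁ x) unitI x)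
    (h₂ : ∀ x ∈ unitI, HasDerivWithinAt g₁ (g₂ x) unitI x)
    (h₃ : ∀ x ∈ unitI, g₂ x = g₂ 0 + ∫ s in (0 : ℝ)..x, w s) {x : ℝ} (hx : x ∈ unitI) :
    g x = g 0 + g₁ 0 * x + g₂ 0 * x ^ 2 / 2 +
      ∫ s in (0 : ℝ)..x, ∫ r in (0 : ℝ)..s, ∫ u in (0 : ℝ)..r, w u := by
  have hcw := continuousOn_primitive_unitI hw
  have hcw₂ := continuousOn_primitive_unitI hcw.integrableOn_unitI
  have hc₂ : ContinuousOn g₂ unitI := (hcw.const_add (g₂ 0)).congr h₃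
  have hc₁ : ContinuousOn g₁ unitI := fun x hx => (h₂ x hx).continuousWithinAt
  have e₁ : ∀ x ∈ unitI, g₁ x = g₁ 0 + g₂ 0 * x +
      ∫ s in (0 : ℝ)..x, ∫ r in (0 : ℝ)..s, w r := by
    intro x hx
    rw [eq_add_integral_of_hasDerivWithinAt h₂ hc₂ hx, intervalIntegral.integral_congr
      (g := fun s => g₂ 0 + ∫ r in (0 : ℝ)..s, w r)
      (fun s hs => h₃ s (ordConnected_Icc.uIcc_subset zero_mem_unitI hx hs)),
      intervalIntegral.integral_add intervalIntegrable_const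
      (intervalIntegrable_of_unitI hcw.integrableOn_unitI zero_mem_unitI hx)]
    simp
    ring
  rw [eq_add_integral_of_hasDerivWithinAt h₁ hc₁ hx, intervalIntegral.integral_congr
      (g := fun s => (g₁ 0 + g₂ 0 * s) + ∫ r in (0 : ℝ)..s, ∫ u in (0 : ℝ)..r, w u)
      (fun s hs => e₁ s (ordConnected_Icc.uIcc_subset zero_mem_unitI hx hs)),
      intervalIntegral.integral_add (Continuous.intervalIntegrable (by fun_prop) _ _)
      (intervalIntegrable_of_unitI hcw₂.integrableOn_unitI zero_mem_unitI hx),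
      intervalIntegral.integral_add (Continuous.intervalIntegrable (by fun_prop) _ _)
      (Continuous.intervalIntegrable (by fun_prop) _ _), intervalIntegral.integral_const_mul,
      integral_id]
  simp
  ring

/-- Functions vanishing at both end points are recovered from `g'(0)` and the third derivative. -/
theorem eq_greenG_of_hasDerivWithinAt {g g₁ g₂ w : ℝ → ℝ} (hw : IntegrableOn w unitI)
    (h₁ : ∀ x ∈ unitI, HasDerivWithinAt g (g₁ x) unitI x)
    (h₂ : ∀ x ∈ unitI, HasDerivWithinAt g₁ (g₂ x) unitI x)
    (h₃ : ∀ x ∈ unitI, g₂ x = g₂ 0 + ∫ s in (0 : ℝ)..x, w s) (hl : g 0 = 0) (hr : g 1 = 0) :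
    g₁ 0 = -(g₂ 0 / 2) - ∫ s in (0 : ℝ)..1, (1 - s) ^ 2 / 2 * w s ∧
    ∀ x ∈ unitI, g x = x * (1 - x) * g₁ 0 + ∫ s in (0 : ℝ)..1, greenG x s * w s := by
  -- Taylor's formula at 1, where g vanishes, trades g₂ 0 for g₁ 0.
  have t₁ := taylor_unitI hw h₁ h₂ h₃ one_mem_unitI
  rw [hr, hl, ← integral_sub_sq_mul hw one_mem_unitI] at t₁
  have t₂ : g₁ 0 = -(g₂ 0 / 2) - ∫ s in (0 : ℝ)..1, (1 - s) ^ 2 / 2 * w s := by linarith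
  refine ⟨t₂, fun x hx => ?_⟩
  rw [integral_greenG_mul hw hx, taylor_unitI hw h₁ h₂ h₃ hx, hl]
  linear_combination x ^ 2 * t₂

/-- Converse of the previous representation: any q and any integrable w define a function with slope
q at 0 and third-derivative density w. It serves to differentiate in ξ formulas obtained after
differentiating or integrating in η. -/
theorem hasDerivWithinAt_greenG_integral {w : ℝ → ℝ} (hw : IntegrableOn w unitI) (q : ℝ) :
    ∃ F₁ F₂ : ℝ → ℝ, F₁ 0 = q ∧
      (∀ x ∈ unitI, HasDerivWithinAt
        (fun x => x * (1 - x) * q + ∫ s in (0 : ℝ)..1, greenG x s * w s) (F₁ x) unitI x) ∧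
      (∀ x ∈ unitI, HasDerivWithinAt F₁ (F₂ x) unitI x) ∧
      ∀ x ∈ unitI, F₂ x = F₂ 0 + ∫ s in (0 : ℝ)..x, w s := by
  have hcw := continuousOn_primitive_unitI hw
  have hcw₂ := continuousOn_primitive_unitI hcw.integrableOn_unitI
  set M := ∫ s in (0 : ℝ)..1, (1 - s) ^ 2 / 2 * w s with hM
  -- By `integral_greenG_mul` the function equals -(q+M)x² + qx plus the triple primitive of w.
  refine ⟨fun x => (-2 * (q + M)) * x + q + ∫ s in (0 : ℝ)..x, ∫ r in (0 : ℝ)..s, w r,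
    fun x => -2 * (q + M) + ∫ s in (0 : ℝ)..x, w s, by simp, fun x hx => ?_, fun x hx => ?_,
    fun x _ => by simp⟩
  · have h := ((hasDerivAt_quintic 0 0 0 (-(q + M)) q 0 x).hasDerivWithinAt (s := unitI)).add
      (hasDerivWithinAt_primitive hcw₂ hx)
    refine (h.congr_of_mem (fun x hx => ?_) hx).congr_deriv ?_
    · rw [integral_greenG_mul hw hx, Pi.add_apply, ← hM]
      ring
    · ring
  · have h := ((hasDerivAt_quintic 0 0 0 0 (-2 * (q + M)) q x).hasDerivWithinAt (s := unitI)).add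
      (hasDerivWithinAt_primitive hcw hx)
    refine (h.congr_of_mem (fun x hx => ?_) hx).congr_deriv ?_
    · rw [Pi.add_apply]
      ring
    · ring

/-! ### Slices and iterated integrals of a density on the square -/

section Fubini

variable {c : ℝ × ℝ → ℝ}

theorem ae_integrableOn_slice (hc : IntegrableOn c unitD) :
    ∀ᵐ η ∂(volume.restrict unitI), IntegrableOn (fun s => c (s, η)) unitI := by
  rw [IntegrableOn, volume_restrict_unitD] at hc
  exact hc.prod_left_ae

theorem integrableOn_mul_left (hc : IntegrableOn c unitD) {K : ℝ → ℝ} (hK : Continuous K) :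
    IntegrableOn (fun p => K p.1 * c p) unitD :=
  hc.continuousOn_mul (g := fun p : ℝ × ℝ => K p.1) (by fun_prop) (isCompact_Icc.prod isCompact_Icc)

theorem integrableOn_mul_right (hc : IntegrableOn c unitD) {k : ℝ → ℝ} (hk : Continuous k) :
    IntegrableOn (fun p => k p.2 * c p) unitD :=
  hc.continuousOn_mul (g := fun p : ℝ × ℝ => k p.2) (by fun_prop) (isCompact_Icc.prod isCompact_Icc)

theorem integrableOn_integral_fst (hc : IntegrableOn c unitD) :
    IntegrableOn (fun σ => ∫ s in (0 : ℝ)..1, c (s, σ)) unitI := by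
  rw [IntegrableOn, volume_restrict_unitD] at hc
  have h := hc.integral_prod_right
  rw [IntegrableOn]
  simpa only [integral_unitI] using h

theorem integrableOn_integral_snd (hc : IntegrableOn c unitD) {η : ℝ} (hη : η ∈ unitI) :
    IntegrableOn (fun s => ∫ σ in (0 : ℝ)..η, c (s, σ)) unitI := by
  have h₁ : IntegrableOn c (unitI ×ˢ Ioc 0 η) := hc.mono_set
    (prod_mono subset_rfl (Ioc_subset_Icc_self.trans (Icc_subset_Icc le_rfl hη.2)))
  rw [IntegrableOn, Measure.volume_eq_prod, ← Measure.prod_restrict] at h₁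
  rw [IntegrableOn]
  simpa only [intervalIntegral.integral_of_le hη.1] using h₁.integral_prod_left

theorem setIntegral_eq_intervalIntegral (hc : IntegrableOn c unitD) {ξ η : ℝ} (hξ : ξ ∈ unitI)
    (hη : η ∈ unitI) :
    ∫ p in Icc 0 ξ ×ˢ Icc 0 η, c p = ∫ s in (0 : ℝ)..ξ, ∫ σ in (0 : ℝ)..η, c (s, σ) := by
  have h := hc.mono_set (prod_mono (Icc_subset_Icc le_rfl hξ.2) (Icc_subset_Icc le_rfl hη.2) :
    Icc 0 ξ ×ˢ Icc 0 η ⊆ unitD)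
  rw [Measure.volume_eq_prod] at h ⊢
  rw [setIntegral_prod c h, intervalIntegral.integral_of_le hξ.1, integral_Icc_eq_integral_Ioc]
  simp only [intervalIntegral.integral_of_le hη.1, integral_Icc_eq_integral_Ioc]

theorem integral_mul_integral_swap (hc : IntegrableOn c unitD) {K : ℝ → ℝ} (hK : Continuous K)
    {η : ℝ} (hη : η ∈ unitI) :
    ∫ s in (0 : ℝ)..1, K s * ∫ σ in (0 : ℝ)..η, c (s, σ) =
      ∫ σ in (0 : ℝ)..η, ∫ s in (0 : ℝ)..1, K s * c (s, σ) := by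
  rw [← intervalIntegral_intervalIntegral_swap (F := fun s σ => K s * c (s, σ))]
  · simp only [intervalIntegral.integral_const_mul]
  · exact (integrableOn_mul_left hc hK).mono_set (prod_mono
      (uIoc_subset_unitI zero_mem_unitI one_mem_unitI) (uIoc_subset_unitI zero_mem_unitI hη))

end Fubini

/-- The Carathéodory representation of `∂³y/∂ξ²∂η` for `y ∈ W_2^{(3,2)}(D)`. -/
structure CaratheodoryRepr (y : ℝ → ℝ → ℝ) (a b : ℝ → ℝ) (c : ℝ × ℝ → ℝ) : Prop where
  mem : MemW32 y
  integrable_fst : IntegrableOn a unitI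
  integrable_snd : IntegrableOn b unitI
  integrable_prod : IntegrableOn c unitD
  eq : ∀ ξ ∈ unitI, ∀ η ∈ unitI, dXi (dXi (dEta y)) ξ η = dXi (dXi (dEta y)) 0 0
    + (∫ s in (0 : ℝ)..ξ, a s) + (∫ s in (0 : ℝ)..η, b s) + ∫ p in Icc 0 ξ ×ˢ Icc 0 η, c p

namespace CaratheodoryRepr

variable {y : ℝ → ℝ → ℝ} {a b : ℝ → ℝ} {c : ℝ × ℝ → ℝ}

theorem dEta_left (h : CaratheodoryRepr y a b c) : ∀ η ∈ unitI, dEta y 0 η = 0 :=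
  dI_zero_of_eqOn h.mem.boundary_left

theorem dEta_right (h : CaratheodoryRepr y a b c) : ∀ η ∈ unitI, dEta y 1 η = 0 :=
  dI_zero_of_eqOn h.mem.boundary_right

theorem integrableOn_density (h : CaratheodoryRepr y a b c) {η : ℝ} (hη : η ∈ unitI) :
    IntegrableOn (fun s => a s + ∫ σ in (0 : ℝ)..η, c (s, σ)) unitI :=
  h.integrable_fst.add (integrableOn_integral_snd h.integrable_prod hη)

theorem eq_left (h : CaratheodoryRepr y a b c) {η : ℝ} (hη : η ∈ unitI) :
    dXi (dXi (dEta y)) 0 η = dXi (dXi (dEta y)) 0 0 + ∫ s in (0 : ℝ)..η, b s := by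
  rw [h.eq 0 zero_mem_unitI η hη, setIntegral_eq_intervalIntegral h.integrable_prod zero_mem_unitI hη]
  simp

/-- For fixed η this exhibits the third-derivative density of ∂_ηy(·,η), so the one-variable
representation applies on each slice. -/
theorem eq_integral_density (h : CaratheodoryRepr y a b c) {ξ η : ℝ} (hξ : ξ ∈ unitI)
    (hη : η ∈ unitI) :
    dXi (dXi (dEta y)) ξ η = dXi (dXi (dEta y)) 0 η +
      ∫ s in (0 : ℝ)..ξ, (a s + ∫ σ in (0 : ℝ)..η, c (s, σ)) := by
  rw [h.eq ξ hξ η hη, h.eq_left hη, setIntegral_eq_intervalIntegral h.integrable_prod hξ hη,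
    intervalIntegral.integral_add (intervalIntegrable_of_unitI h.integrable_fst zero_mem_unitI hξ)
    (intervalIntegrable_of_unitI (integrableOn_integral_snd h.integrable_prod hη) zero_mem_unitI hξ)]
  ring

theorem integral_mul_density (h : CaratheodoryRepr y a b c) {K : ℝ → ℝ} (hK : Continuous K) {η : ℝ}
    (hη : η ∈ unitI) :
    ∫ s in (0 : ℝ)..1, K s * (a s + ∫ σ in (0 : ℝ)..η, c (s, σ)) =
      (∫ s in (0 : ℝ)..1, K s * a s) + ∫ σ in (0 : ℝ)..η, ∫ s in (0 : ℝ)..1, K s * c (s, σ) := by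
  have h₁ := intervalIntegrable_of_unitI h.integrable_fst zero_mem_unitI one_mem_unitI
  have h₂ := intervalIntegrable_of_unitI (integrableOn_integral_snd h.integrable_prod hη)
    zero_mem_unitI one_mem_unitI
  simp only [mul_add]
  rw [intervalIntegral.integral_add (h₁.continuousOn_mul hK.continuousOn)
    (h₂.continuousOn_mul hK.continuousOn), integral_mul_integral_swap h.integrable_prod hK hη]

theorem greenG_repr (h : CaratheodoryRepr y a b c) {η : ℝ} (hη : η ∈ unitI) :
    dXi (dEta y) 0 η = -(dXi (dXi (dEta y)) 0 η / 2) -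
      ∫ s in (0 : ℝ)..1, (1 - s) ^ 2 / 2 * (a s + ∫ σ in (0 : ℝ)..η, c (s, σ)) ∧
    ∀ ξ ∈ unitI, dEta y ξ η = ξ * (1 - ξ) * dXi (dEta y) 0 η +
      ∫ s in (0 : ℝ)..1, greenG ξ s * (a s + ∫ σ in (0 : ℝ)..η, c (s, σ)) :=
  eq_greenG_of_hasDerivWithinAt (g := fun ξ => dEta y ξ η) (g₁ := fun ξ => dXi (dEta y) ξ η)
    (g₂ := fun ξ => dXi (dXi (dEta y)) ξ η) (h.integrableOn_density hη)
    (fun ξ hξ => (h.mem.exists_third ξ hξ η hη).2.1.hasDerivWithinAt)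
    (fun ξ hξ => (h.mem.exists_third ξ hξ η hη).2.2.hasDerivWithinAt)
    (fun _ hξ => h.eq_integral_density hξ hη) (h.dEta_left η hη) (h.dEta_right η hη)

theorem integrableOn_edge (h : CaratheodoryRepr y a b c) :
    IntegrableOn (fun σ => -(b σ / 2) - ∫ s in (0 : ℝ)..1, (1 - s) ^ 2 / 2 * c (s, σ)) unitI :=
  (h.integrable_snd.div_const 2).neg.sub (integrableOn_integral_fst
    (integrableOn_mul_left (K := fun s => (1 - s) ^ 2 / 2) h.integrable_prod (by fun_prop)))

theorem integrableOn_green (h : CaratheodoryRepr y a b c) (ξ : ℝ) :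
    IntegrableOn (fun σ => ∫ s in (0 : ℝ)..1, greenG ξ s * c (s, σ)) unitI :=
  integrableOn_integral_fst (integrableOn_mul_left h.integrable_prod (continuous_greenG ξ))

/-- Absolute continuity of `∂²y/∂ξ∂η` along the edge `ξ = 0`. -/
theorem dXi_dEta_left (h : CaratheodoryRepr y a b c) {η : ℝ} (hη : η ∈ unitI) :
    dXi (dEta y) 0 η = dXi (dEta y) 0 0 +
      ∫ σ in (0 : ℝ)..η, (-(b σ / 2) - ∫ s in (0 : ℝ)..1, (1 - s) ^ 2 / 2 * c (s, σ)) := by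
  have hK : Continuous fun s : ℝ => (1 - s) ^ 2 / 2 := by fun_prop
  have hb := intervalIntegrable_of_unitI h.integrable_snd zero_mem_unitI hη
  have hi : IntervalIntegrable (fun σ => ∫ s in (0 : ℝ)..1, (1 - s) ^ 2 / 2 * c (s, σ)) volume 0 η :=
    intervalIntegrable_of_unitI (integrableOn_integral_fst
      (integrableOn_mul_left h.integrable_prod hK)) zero_mem_unitI hη
  rw [(h.greenG_repr hη).1, (h.greenG_repr zero_mem_unitI).1, h.integral_mul_density hK hη,
    h.integral_mul_density hK zero_mem_unitI, intervalIntegral.integral_sub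
    (f := fun σ => -(b σ / 2)) (hb.div_const 2).neg hi, intervalIntegral.integral_neg, intervalIntegral.integral_div,
    intervalIntegral.integral_same, h.eq_left hη]
  ring

theorem dEta_eq (h : CaratheodoryRepr y a b c) {ξ η : ℝ} (hξ : ξ ∈ unitI) (hη : η ∈ unitI) :
    dEta y ξ η = ξ * (1 - ξ) * dXi (dEta y) 0 η + (∫ s in (0 : ℝ)..1, greenG ξ s * a s) +
      ∫ σ in (0 : ℝ)..η, ∫ s in (0 : ℝ)..1, greenG ξ s * c (s, σ) := by
  rw [(h.greenG_repr hη).2 ξ hξ, h.integral_mul_density (continuous_greenG ξ) hη]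
  ring

theorem continuousOn_dXi_dEta_left (h : CaratheodoryRepr y a b c) :
    ContinuousOn (fun η => dXi (dEta y) 0 η) unitI :=
  ((continuousOn_primitive_unitI h.integrableOn_edge).const_add _).congr
    fun _ hη => h.dXi_dEta_left hη

/-- Integrate the slice representation of ∂_ηy from η = 0, where y vanishes; Cauchy's formula turns
the double primitive in η into the weight t - σ. -/
theorem eq_repr (h : CaratheodoryRepr y a b c) {ξ t : ℝ} (hξ : ξ ∈ unitI) (ht : t ∈ unitI) :
    y ξ t = ξ * (1 - ξ) * (∫ η in (0 : ℝ)..t, dXi (dEta y) 0 η) +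
      t * (∫ s in (0 : ℝ)..1, greenG ξ s * a s) +
      ∫ σ in (0 : ℝ)..t, (t - σ) * ∫ s in (0 : ℝ)..1, greenG ξ s * c (s, σ) := by
  have hp := h.continuousOn_dXi_dEta_left
  have hE := continuousOn_primitive_unitI (h.integrableOn_green ξ)
  have hcont : ContinuousOn (fun η => dEta y ξ η) unitI :=
    (((hp.const_mul (ξ * (1 - ξ))).add continuousOn_const).add hE).congr
      fun η hη => h.dEta_eq hξ hη
  rw [eq_add_integral_of_hasDerivWithinAt (f := fun s => y ξ s) (f' := fun s => dEta y ξ s)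
    (fun η hη => (h.mem.exists_third ξ hξ η hη).1.hasDerivWithinAt) hcont ht, h.mem.initial ξ hξ,
    integral_sub_mul (h.integrableOn_green ξ) ht]
  have hpi := intervalIntegrable_of_unitI hp.integrableOn_unitI zero_mem_unitI ht
  have hEi := intervalIntegrable_of_unitI hE.integrableOn_unitI zero_mem_unitI ht
  rw [intervalIntegral.integral_congr (fun η hη => h.dEta_eq hξ
      (ordConnected_Icc.uIcc_subset zero_mem_unitI ht hη)),
    intervalIntegral.integral_add ((hpi.const_mul _).add intervalIntegrable_const) hEi,
    intervalIntegral.integral_add (hpi.const_mul _) intervalIntegrable_const,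
    intervalIntegral.integral_const_mul]
  simp

/-- The definition of the space controls ∂_ξ after ∂_η, whereas the inner product contains ∂_η²∂_ξy.
For fixed t, `eq_repr` has the form ξ(1-ξ)q + ∫G w with w = t a + ∫₀^t(t-σ)c, so the slope at ξ = 0
is q. -/
theorem dXi_left (h : CaratheodoryRepr y a b c) {t : ℝ} (ht : t ∈ unitI) :
    dXi y 0 t = ∫ η in (0 : ℝ)..t, dXi (dEta y) 0 η := by
  have hk : Continuous fun σ => t - σ := by fun_prop
  have hkc := integrableOn_mul_right h.integrable_prod hk
  have hw : IntegrableOn (fun s => t * a s + ∫ σ in (0 : ℝ)..t, (t - σ) * c (s, σ)) unitI :=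
    (h.integrable_fst.const_mul t).add (integrableOn_integral_snd hkc ht)
  obtain ⟨F₁, -, hF₁, hF, -⟩ := hasDerivWithinAt_greenG_integral hw
    (∫ η in (0 : ℝ)..t, dXi (dEta y) 0 η)
  rw [← hF₁]
  refine HasDerivWithinAt.dI_eq ((hF 0 zero_mem_unitI).congr_of_mem (fun ξ hξ => ?_)
    zero_mem_unitI) zero_mem_unitI
  have h₁ := intervalIntegrable_of_unitI h.integrable_fst zero_mem_unitI one_mem_unitI
  have h₂ := intervalIntegrable_of_unitI (integrableOn_integral_snd hkc ht)
    zero_mem_unitI one_mem_unitI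
  have hG := (continuous_greenG ξ).continuousOn (s := uIcc 0 1)
  have hsplit : ∫ s in (0 : ℝ)..1, greenG ξ s * (t * a s + ∫ σ in (0 : ℝ)..t, (t - σ) * c (s, σ)) =
      t * (∫ s in (0 : ℝ)..1, greenG ξ s * a s) +
      ∫ σ in (0 : ℝ)..t, (t - σ) * ∫ s in (0 : ℝ)..1, greenG ξ s * c (s, σ) := by
    simp only [mul_add]
    rw [intervalIntegral.integral_add ((h₁.const_mul t).continuousOn_mul hG)
      (h₂.continuousOn_mul hG), integral_mul_integral_swap hkc (continuous_greenG ξ) ht,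
      ← intervalIntegral.integral_const_mul]
    simp only [← intervalIntegral.integral_const_mul, mul_left_comm]
  rw [hsplit, h.eq_repr hξ ht]
  ring

theorem dEta_dXi_left (h : CaratheodoryRepr y a b c) {η : ℝ} (hη : η ∈ unitI) :
    dEta (dXi y) 0 η = dXi (dEta y) 0 η :=
  ((hasDerivWithinAt_primitive h.continuousOn_dXi_dEta_left hη).congr_of_mem
    (fun _ hs => h.dXi_left hs) hη).dI_eq hη

theorem ae_dEta_dEta_dXi_left (h : CaratheodoryRepr y a b c) :
    ∀ᵐ η ∂(volume.restrict unitI), dEta (dEta (dXi y)) 0 η =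
      -(b η / 2) - ∫ s in (0 : ℝ)..1, (1 - s) ^ 2 / 2 * c (s, η) := by
  filter_upwards [ae_hasDerivWithinAt_of_absCont h.integrableOn_edge
    (fun η hη => h.dXi_dEta_left hη), ae_restrict_mem measurableSet_unitI] with η hd hη
  rw [dEta_eqOn (fun s hs => h.dEta_dXi_left hs) η hη]
  exact hd.dI_eq hη

theorem ae_dXi_initial (h : CaratheodoryRepr y a b c) :
    ∀ᵐ ξ ∂(volume.restrict unitI), dXi (dXi (dXi (dEta y))) ξ 0 = a ξ := by
  filter_upwards [ae_hasDerivWithinAt_of_absCont (f := fun ξ => dXi (dXi (dEta y)) ξ 0)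
    h.integrable_fst (fun ξ hξ => by simpa using h.eq_integral_density hξ zero_mem_unitI),
    ae_restrict_mem measurableSet_unitI] with ξ hd hξ
  exact hd.dI_eq hξ

theorem unitI_subset_closure_rat :
    unitI ⊆ closure (Ioo (0 : ℝ) 1 ∩ range ((↑) : ℚ → ℝ)) := by
  rw [unitI, ← closure_Ioo zero_ne_one]
  exact closure_minimal ((Rat.denseRange_cast (𝕜 := ℝ)).open_subset_closure_inter isOpen_Ioo)
    isClosed_closure

/-- For each ξ the formula follows by differentiating `dEta_eq`, but the null set depends on ξ. It
is uniform over rational ξ, and continuity of both sides in ξ extends the equality to all of [0,1];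
on the left, continuity comes from the existence of ∂_ξ∂_η²y at every ξ. -/
theorem ae_dEta_dEta (h : CaratheodoryRepr y a b c) :
    ∀ᵐ η ∂(volume.restrict unitI), ∀ ξ ∈ unitI, dEta (dEta y) ξ η =
      ξ * (1 - ξ) * (-(b η / 2) - ∫ s in (0 : ℝ)..1, (1 - s) ^ 2 / 2 * c (s, η)) +
        ∫ s in (0 : ℝ)..1, greenG ξ s * c (s, η) := by
  have hpt : ∀ ξ ∈ unitI, ∀ᵐ η ∂(volume.restrict unitI), dEta (dEta y) ξ η =
      ξ * (1 - ξ) * (-(b η / 2) - ∫ s in (0 : ℝ)..1, (1 - s) ^ 2 / 2 * c (s, η)) +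
        ∫ s in (0 : ℝ)..1, greenG ξ s * c (s, η) := by
    intro ξ hξ
    filter_upwards [ae_hasDerivWithinAt_of_absCont h.integrableOn_edge
      (fun η hη => h.dXi_dEta_left hη), ae_hasDerivWithinAt_primitive (h.integrableOn_green ξ),
      ae_restrict_mem measurableSet_unitI] with η h₁ h₂ hη
    exact ((((h₁.const_mul (ξ * (1 - ξ))).add_const _).add h₂).congr_of_mem
      (fun s hs => h.dEta_eq hξ hs) hη).dI_eq hη
  have hrat : ∀ᵐ η ∂(volume.restrict unitI), ∀ ξ ∈ Ioo (0 : ℝ) 1 ∩ range ((↑) : ℚ → ℝ),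
      dEta (dEta y) ξ η =
      ξ * (1 - ξ) * (-(b η / 2) - ∫ s in (0 : ℝ)..1, (1 - s) ^ 2 / 2 * c (s, η)) +
        ∫ s in (0 : ℝ)..1, greenG ξ s * c (s, η) :=
    (ae_ball_iff ((countable_range _).mono inter_subset_right)).2
      fun ξ hξ => hpt ξ (Ioo_subset_Icc_self hξ.1)
  filter_upwards [hrat, h.mem.exists_fifth, ae_integrableOn_slice h.integrable_prod]
    with η hη hfifth hc
  obtain ⟨F₁, -, -, hF, -⟩ := hasDerivWithinAt_greenG_integral hc
    (-(b η / 2) - ∫ s in (0 : ℝ)..1, (1 - s) ^ 2 / 2 * c (s, η))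
  exact EqOn.of_subset_closure (f := fun ξ => dEta (dEta y) ξ η) hη
    (fun ξ hξ => (hfifth.1 ξ hξ).2.1.continuousWithinAt)
    (fun ξ hξ => (hF ξ hξ).continuousWithinAt)
    (inter_subset_left.trans Ioo_subset_Icc_self) unitI_subset_closure_rat

/-- At a good η the formula for ∂_η²y holds for every ξ, so it may be differentiated three times in
ξ; its third-derivative density is c(·,η). -/
theorem ae_fifth (h : CaratheodoryRepr y a b c) :
    ∀ᵐ η ∂(volume.restrict unitI), ∀ᵐ ξ ∂(volume.restrict unitI),
      dXi (dXi (dXi (dEta (dEta y)))) ξ η = c (ξ, η) := by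
  filter_upwards [h.ae_dEta_dEta, ae_integrableOn_slice h.integrable_prod] with η hη hc
  obtain ⟨F₁, F₂, -, hF, hF', hF₂⟩ := hasDerivWithinAt_greenG_integral hc
    (-(b η / 2) - ∫ s in (0 : ℝ)..1, (1 - s) ^ 2 / 2 * c (s, η))
  filter_upwards [ae_hasDerivWithinAt_of_absCont hc hF₂, ae_restrict_mem measurableSet_unitI]
    with ξ hd hξ
  have e₁ : ∀ ξ ∈ unitI, dXi (dEta (dEta y)) ξ η = F₁ ξ := fun ξ hξ =>
    ((hF ξ hξ).congr_of_mem hη hξ).dI_eq hξ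
  have e₂ : ∀ ξ ∈ unitI, dXi (dXi (dEta (dEta y))) ξ η = F₂ ξ := fun ξ hξ =>
    ((hF' ξ hξ).congr_of_mem e₁ hξ).dI_eq hξ
  exact (hd.congr_of_mem e₂ hξ).dI_eq hξ

end CaratheodoryRepr

/-! ### The reproducing property -/

theorem integral_congr_ae_unitI {f g : ℝ → ℝ}
    (h : ∀ᵐ s ∂(volume.restrict unitI), f s = g s) :
    ∫ s in (0 : ℝ)..1, f s = ∫ s in (0 : ℝ)..1, g s := by
  rw [← integral_unitI, ← integral_unitI]
  exact integral_congr_ae h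

theorem integral_congr_unitI {f g : ℝ → ℝ} (h : ∀ s ∈ unitI, f s = g s) :
    ∫ s in (0 : ℝ)..1, f s = ∫ s in (0 : ℝ)..1, g s :=
  integral_congr_ae_unitI (ae_restrict_of_forall_mem measurableSet_unitI h)

theorem R3d₁_zero {x : ℝ} (hx : x ∈ unitI) : R3d₁ x 0 = x * (1 - x) := by
  rw [R3d₁, max_eq_right (by linarith [hx.1])]; ring

theorem R2d₁_zero {t : ℝ} (ht : t ∈ unitI) : R2d₁ t 0 = t := by
  rw [R2d₁, max_eq_right (by linarith [ht.1])]; ring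

/-! ### Derivatives of the kernel entering the inner product -/

section Kernel

variable {x t : ℝ}

theorem dEta_kernelK (ξ : ℝ) : ∀ η ∈ unitI, dEta (kernelK x t) ξ η = R3 x ξ * R2d₁ t η :=
  fun η hη => ((hasDerivAt_R2 t η).const_mul (R3 x ξ)).hasDerivWithinAt.dI_eq hη

theorem dEta_dEta_kernelK (ξ : ℝ) :
    ∀ η ∈ unitI, dEta (dEta (kernelK x t)) ξ η = R3 x ξ * max (t - η) 0 := fun η hη => by
  rw [dEta_eqOn (v := fun ξ η => R3 x ξ * R2d₁ t η) (dEta_kernelK ξ) η hη]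
  exact ((hasDerivAt_R2d₁ t η).const_mul (R3 x ξ)).hasDerivWithinAt.dI_eq hη

theorem dXi_kernelK (η : ℝ) : ∀ ξ ∈ unitI, dXi (kernelK x t) ξ η = R3d₁ x ξ * R2 t η :=
  fun ξ hξ => ((hasDerivAt_R3 x ξ).mul_const (R2 t η)).hasDerivWithinAt.dI_eq hξ

theorem dEta_dEta_dXi_kernelK {ξ : ℝ} (hξ : ξ ∈ unitI) :
    ∀ η ∈ unitI, dEta (dEta (dXi (kernelK x t))) ξ η = R3d₁ x ξ * max (t - η) 0 := by
  have e₁ : ∀ η ∈ unitI, dEta (dXi (kernelK x t)) ξ η = R3d₁ x ξ * R2d₁ t η := fun η hη => by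
    rw [dEta_eqOn (v := fun ξ η => R3d₁ x ξ * R2 t η) (fun η _ => dXi_kernelK η ξ hξ) η hη]
    exact ((hasDerivAt_R2 t η).const_mul (R3d₁ x ξ)).hasDerivWithinAt.dI_eq hη
  intro η hη
  rw [dEta_eqOn (v := fun ξ η => R3d₁ x ξ * R2d₁ t η) e₁ η hη]
  exact ((hasDerivAt_R2d₁ t η).const_mul (R3d₁ x ξ)).hasDerivWithinAt.dI_eq hη

theorem dI_R3_mul {f : ℝ → ℝ} {k : ℝ} (hf : ∀ ξ ∈ unitI, f ξ = R3 x ξ * k) :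
    (∀ ξ ∈ unitI, dI f ξ = R3d₁ x ξ * k) ∧
      ∀ ξ ∈ unitI, dI (dI (dI f)) ξ = greenG x ξ * k := by
  have e₁ : ∀ ξ ∈ unitI, dI f ξ = R3d₁ x ξ * k := fun ξ hξ =>
    (((hasDerivAt_R3 x ξ).mul_const k).hasDerivWithinAt.congr_of_mem hf hξ).dI_eq hξ
  have e₂ : ∀ ξ ∈ unitI, dI (dI f) ξ = R3d₂ x ξ * k := fun ξ hξ =>
    (((hasDerivAt_R3d₁ x ξ).mul_const k).hasDerivWithinAt.congr_of_mem e₁ hξ).dI_eq hξ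
  exact ⟨e₁, fun ξ hξ =>
    (((hasDerivAt_R3d₂ x ξ).mul_const k).hasDerivWithinAt.congr_of_mem e₂ hξ).dI_eq hξ⟩

theorem fifth_kernelK : ∀ ξ ∈ unitI, ∀ η ∈ unitI,
    dXi (dXi (dXi (dEta (dEta (kernelK x t))))) ξ η = greenG x ξ * max (t - η) 0 :=
  fun ξ hξ η hη => (dI_R3_mul (f := fun ξ => dEta (dEta (kernelK x t)) ξ η)
    fun ξ _ => dEta_dEta_kernelK ξ η hη).2 ξ hξ

end Kernel

theorem innerW3_eq_zero {g f : ℝ → ℝ} (hg : ∀ ξ ∈ unitI, g ξ = 0) : innerW3 g f = 0 := by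
  have h₁ := dI_zero_of_eqOn hg
  have h₃ := dI_zero_of_eqOn (dI_zero_of_eqOn h₁)
  rw [innerW3, hg 0 zero_mem_unitI, hg 1 one_mem_unitI, h₁ 0 zero_mem_unitI,
    integral_congr_unitI (g := fun _ => 0) fun ξ hξ => by rw [h₃ ξ hξ, zero_mul]]
  simp

theorem integral_mul_max_sub {w : ℝ → ℝ} (hw : IntegrableOn w unitI) {t : ℝ} (ht : t ∈ unitI) :
    ∫ η in (0 : ℝ)..1, max (t - η) 0 * w η = ∫ η in (0 : ℝ)..t, (t - η) * w η := by
  simpa using integral_truncated_pow_mul w one_ne_zero ht hw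

/-- The edge terms vanish because R_x(0) = R_x(1) = 0, and the trace of y at η = 0 is zero. The term
along ξ = 0 gives x(1-x)(∫₀^t p - t p(0)); the trace of ∂_ηy gives x(1-x) t p(0) + t∫G a, cancelling
p(0); the double integral gives the term in c. The sum is `eq_repr`. -/
theorem innerW32_kernelK {y : ℝ → ℝ → ℝ} (hy : MemW32 y) {x t : ℝ} (hx : x ∈ unitI)
    (ht : t ∈ unitI) : innerW32 y (kernelK x t) = y x t := by
  obtain ⟨a, b, c, ha, hb, hc, heq⟩ := hy.absCont
  have h : CaratheodoryRepr y a b c := ⟨hy, ha, hb, hc, heq⟩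
  have T₁ : ∫ η in (0 : ℝ)..1, dEta (dEta y) 0 η * dEta (dEta (kernelK x t)) 0 η = 0 := by
    rw [integral_congr_unitI (g := fun _ => 0) fun η hη => by
      rw [dEta_dEta_kernelK 0 η hη, R3_zero hx]; ring]
    simp
  have T₃ : ∫ η in (0 : ℝ)..1, dEta (dEta y) 1 η * dEta (dEta (kernelK x t)) 1 η = 0 := by
    rw [integral_congr_unitI (g := fun _ => 0) fun η hη => by
      rw [dEta_dEta_kernelK 1 η hη, R3_one hx]; ring]
    simp
  have T₂ : ∫ η in (0 : ℝ)..1, dEta (dEta (dXi y)) 0 η * dEta (dEta (dXi (kernelK x t))) 0 η =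
      x * (1 - x) * ((∫ η in (0 : ℝ)..t, dXi (dEta y) 0 η) - t * dXi (dEta y) 0 0) := by
    rw [integral_congr_ae_unitI (g := fun η => x * (1 - x) * (max (t - η) 0 *
      (-(b η / 2) - ∫ s in (0 : ℝ)..1, (1 - s) ^ 2 / 2 * c (s, η))))]
    · rw [intervalIntegral.integral_const_mul, integral_mul_max_sub h.integrableOn_edge ht,
        integral_sub_mul h.integrableOn_edge ht]
      have hp := intervalIntegrable_of_unitI
        (continuousOn_primitive_unitI h.integrableOn_edge).integrableOn_unitI zero_mem_unitI ht
      rw [intervalIntegral.integral_congr (fun η hη => h.dXi_dEta_left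
        (ordConnected_Icc.uIcc_subset zero_mem_unitI ht hη)),
        intervalIntegral.integral_add intervalIntegrable_const hp]
      simp
    · filter_upwards [h.ae_dEta_dEta_dXi_left, ae_restrict_mem measurableSet_unitI] with η h₁ hη
      rw [h₁, dEta_dEta_dXi_kernelK zero_mem_unitI η hη, R3d₁_zero hx]
      ring
  have T₄ : innerW3 (fun ξ => y ξ 0) (fun ξ => kernelK x t ξ 0) = 0 := innerW3_eq_zero hy.initial
  have T₅ : innerW3 (fun ξ => dEta y ξ 0) (fun ξ => dEta (kernelK x t) ξ 0) =
      x * (1 - x) * (t * dXi (dEta y) 0 0) + t * ∫ s in (0 : ℝ)..1, greenG x s * a s := by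
    have hK : ∀ ξ ∈ unitI, dEta (kernelK x t) ξ 0 = R3 x ξ * t := fun ξ _ => by
      rw [dEta_kernelK ξ 0 zero_mem_unitI, R2d₁_zero ht]
    obtain ⟨e₁, e₃⟩ := dI_R3_mul hK
    rw [innerW3, h.dEta_left 0 zero_mem_unitI, h.dEta_right 0 zero_mem_unitI,
      e₁ 0 zero_mem_unitI, R3d₁_zero hx, integral_congr_ae_unitI
        (g := fun ξ => t * (greenG x ξ * a ξ)), intervalIntegral.integral_const_mul]
    · change 0 * _ + dXi (dEta y) 0 0 * _ + 0 * _ + _ = _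
      ring
    · filter_upwards [h.ae_dXi_initial, ae_restrict_mem measurableSet_unitI] with ξ h₁ hξ
      rw [e₃ ξ hξ]
      change dXi (dXi (dXi (dEta y))) ξ 0 * _ = _
      rw [h₁]
      ring
  have T₆ : ∫ η in (0 : ℝ)..1, ∫ ξ in (0 : ℝ)..1, dXi (dXi (dXi (dEta (dEta y)))) ξ η *
      dXi (dXi (dXi (dEta (dEta (kernelK x t))))) ξ η =
      ∫ σ in (0 : ℝ)..t, (t - σ) * ∫ s in (0 : ℝ)..1, greenG x s * c (s, σ) := by
    rw [← integral_mul_max_sub (h.integrableOn_green x) ht]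
    refine integral_congr_ae_unitI ?_
    filter_upwards [h.ae_fifth, ae_restrict_mem measurableSet_unitI] with η h₁ hη
    rw [← intervalIntegral.integral_const_mul]
    refine integral_congr_ae_unitI ?_
    filter_upwards [h₁, ae_restrict_mem measurableSet_unitI] with ξ h₂ hξ
    rw [h₂, fifth_kernelK ξ hξ η hη]
    ring
  rw [innerW32, T₁, T₂, T₃, T₄, T₅, T₆, h.eq_repr hx ht]
  ring

theorem theorem3p1 (α : ℝ) (hα₀ : 0 < α) (hα₁ : α ≤ 1)
    (k₁ k₂ k₃ : ℝ → ℝ → ℝ)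
    (hk₁ : ContinuousOn (fun p : ℝ × ℝ => k₁ p.1 p.2) unitD)
    (hk₂ : ContinuousOn (fun p : ℝ × ℝ => k₂ p.1 p.2) unitD)
    (hk₃ : ContinuousOn (fun p : ℝ × ℝ => k₃ p.1 p.2) unitD)
    (ξ η : ℕ → ℝ) (hD : ∀ i, (ξ i, η i) ∈ unitD) :
    IsReproducingKernelW32 kernelK ∧
      ∀ i, MemW32 (psi α k₁ k₂ k₃ kernelK (ξ i) (η i)) :=
  ⟨⟨fun _ hx _ ht => memW32_kernelK hx ht, fun _ hy _ hx _ ht => innerW32_kernelK hy hx ht⟩,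
    fun i => memW32_psi hα₁ k₁ k₂ k₃ (hD i).1 (hD i).2⟩
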